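/- **Conventions.** For $m\ge 1$ put $t_i^{m}=-1+\frac{2i}{m+1}$ $(1\le i\le m)$. For $0\le p<n$ let $e^m=(e^m_1,\dots,e^m_m):\coprod_1^m\mathbb R^p\to\mathbb R^n$, $e^m_i(x)=(t_i^m,0,\dots,0,x_1,\dots,x_p)$. Let $\mathcal L_{m\cdot p}^n$ be the space of long links: smooth embeddings $f=(f_1,\dots,f_m):\coprod_1^m\mathbb R^p\to\mathbb R^n$ that map $\coprod_1^m(-1,1)^p$ into $(-1,1)^n$ and agree with $e^m$ outside $\coprod_1^m(-1,1)^p$, with the $C^\infty$ topology and basepoint $e^m$. Let $\Omega\mathcal L_{m\cdot p}^n$ be the space of smooth loops, i.e. of families $\omega=(\omega_t)_{t\in\mathbb R}$ in $\mathcal L_{m\cdot p}^n$ for which $(t,x)\mapsto\omega_t(x)$ is smooth and $\omega_t=e^m$ for $t\notin[-1,1]$, with the $C^\infty$ topology. The graphing map $G:\Omega\mathcal L_{m\cdot p}^n\to\mathcal L_{m\cdot(p+1)}^{n+1}$ is $G(\omega)_i(x_1,\dots,x_{p+1})=\big((\omega_{x_{p+1}})_i(x_1,\dots,x_p),\,x_{p+1}\big)$.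 **Joining data.** Let $m\ge2$ and $c\ge 2$. Write points of $\mathbb R^{c+1}$ as $(x_1,\dots,x_c,y)$, and let $\ell_i=\{(t_i^m,0,\dots,0,y):y\in\mathbb R\}$. Joining data for $(m,c)$ consist of the following. * Numbers $0<\varepsilon<1/m$ and $k>2$, and a smooth coordinate system (a diffeomorphism $\Psi$ between open sets) $\Psi(u,v)$, $u\in\mathbb R$, $v\in\mathbb R^c$, of an open subset of $\mathbb R^{c+1}$, whose domain contains $[0,1]\times\{|v|\le1+\varepsilon\}$. It is a framed tubular neighbourhood of the path $\gamma(u)=\Psi(u,0)$, $0\le u\le 1$. For $|w|\le1$, $\Psi(0,(0,\dots,0,w))=(t_m^m,0,\dots,0,w)$ and $\Psi(1,(0,\dots,0,w))=(t_{m-1}^m,0,\dots,0,k+w)$; and $\gamma'(0),\gamma'(1)$ have last coordinate $0$. * Let $H=\{\Psi(u,(0,\dots,0,w)):0\le u\le 1,\ |w|\le 1\}$ and let $N$ be the set of points at distance at most $\varepsilon$ from $H$. Then $N$ lies in the image of $\Psi$; both $N$ and $\Psi\big((0,1)\times\{|v|<1+\varepsilon\}\big)$ lie in $[-1,1]\times[-2k,2k]^c$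 and miss $[-1,t_{m-1}^m+\varepsilon]\times[-1,1]^c$; and the second set misses $\ell_1,\dots,\ell_{m-1}$. If $\Psi(u,v)\in N\cap[-1,1]^{c+1}$ and $\Psi(u',v)\in N\cap(\ell_1\cup\dots\cup\ell_{m-1})$, then $u'=1$ and $v=(0,\dots,0,w)$ with $|w|\le1$. * A smooth diffeotopy $\varphi_s$, $0\le s\le1$, of $\mathbb R^{c+1}$ with $\varphi_0=\mathrm{id}$ and $\varphi_s=\mathrm{id}$ outside $N$; with $\varphi_s(\Psi(u,(0,\dots,0,w)))=\Psi(u+s,(0,\dots,0,w))$ if $u,s\ge0$, $u+s\le 1$, $|w|\le 1$; and such that for $\Psi(u,v)\in N$ one has $\varphi_s(\Psi(u,v))=\Psi(u',v)$ for some $u'\in[u,u+s]$. * An increasing diffeomorphism $S$ of $\mathbb R$ with $S((-1,1))\subset(-1,1)$ and $S(t_i^m)=t_i^{m-1}$ for $1\le i\le m-1$. **Joining.** Fix joining data for $(m,c)$. For all $p\ge1$ and $n=p+c$ and $f\in\mathcal L_{m\cdot p}^n$, define $\tilde f=(\tilde f_1,\dots,\tilde f_{m-1})$ by $\tilde f_i=(\varphi_1\times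 1_{p-1})\circ f_i$ on $[-1,1]^p$; $\tilde f_{m-1}=(\varphi_1\times1_{p-1})\circ f_m\circ T$ on $[k-1,k+1]\times[-1,1]^{p-1}$, where $T(x)=(x_1-k,x_2,\dots,x_p)$; and $\tilde f_i=e^m_i$ elsewhere. Put $J(f)_i=\big((S,\tfrac1{2k},\dots,\tfrac1{2k})\times1_{p-1}\big)\circ\tilde f_i\circ(2k\times 1_{p-1})$, with $c$ factors $\tfrac1{2k}$. **Proposition.** Let $m\ge2$ and $1\le p\le n-2$, and fix any joining data for $(m,n-p)$; use them for joining both in $\mathbb R^n$ and in $\mathbb R^{n+1}$. Then $J$ defines continuous maps $\mathcal L_{m\cdot p}^n\to\mathcal L_{(m-1)\cdot p}^n$ and $\mathcal L_{m\cdot(p+1)}^{n+1}\to\mathcal L_{(m-1)\cdot(p+1)}^{n+1}$, applying $J$ to each $\omega_t$ defines a continuous map $\Omega J:\Omega\mathcal L_{m\cdot p}^n\to\Omega\mathcal L_{(m-1)\cdot p}^n$, the graphing maps $G$ on $\Omega\mathcal L_{m\cdot p}^n$ and $\Omega\mathcal L_{(m-1)\cdot p}^n$ are well defined and continuous, and $J\circ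 G=G\circ\Omega J$ as maps $\Omega\mathcal L_{m\cdot p}^n\to\mathcal L_{(m-1)\cdot(p+1)}^{n+1}$. In particular $J\circ G$ and $G\circ\Omega J$ are homotopic. -/

import Mathlib

open Set Topology
open scoped ContDiff

noncomputable section

namespace LongLinks

/-- Euclidean space `ℝ^n`. -/
abbrev E (n : ℕ) : Type := EuclideanSpace ℝ (Fin n)

/-! ### Spaces of smooth maps -/

/-- Smooth maps between normed spaces. -/
structure SmoothMap (V W : Type) [NormedAddCommGroup V] [NormedSpace ℝ V]
    [NormedAddCommGroup W] [NormedSpace ℝ W] where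
  toFun : V → W
  smooth : ContDiff ℝ ∞ toFun

/-- The `k`-th derivative of a smooth map, as a continuous map. -/
def SmoothMap.jet {V W : Type} [NormedAddCommGroup V] [NormedSpace ℝ V]
    [NormedAddCommGroup W] [NormedSpace ℝ W] (k : ℕ) (f : SmoothMap V W) :
    C(V, V [×k]→L[ℝ] W) :=
  ⟨iteratedFDeriv ℝ k f.toFun, f.smooth.continuous_iteratedFDeriv (by exact_mod_cast le_top)⟩

/-- The `C^∞` topology: uniform convergence of every derivative on compact sets.
It is used below only on families of maps that all agree outside a fixed cube `[-1,1]^N`; on such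
a family it coincides with the strong (Whitney) `C^∞` topology. -/
instance {V W : Type} [NormedAddCommGroup V] [NormedSpace ℝ V]
    [NormedAddCommGroup W] [NormedSpace ℝ W] : TopologicalSpace (SmoothMap V W) :=
  ⨅ k : ℕ, TopologicalSpace.induced (SmoothMap.jet k) inferInstance

/-! ### Long links -/

/-- `t_i^* = -1 + 2 i / (m + 1)`, for `i = 1, …, m`. -/
def tstar (m i : ℕ) : ℝ := -1 + 2 * (i : ℝ) / ((m : ℝ) + 1)

/-- The standard link: `e_i (x_1, …, x_p) = (t_i^*, 0, …, 0, x_1, …, x_p)`. The components are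
indexed by `Fin m`, so the component `i : Fin m` is the `(i + 1)`-st one. -/
def stdLink (m p n : ℕ) (i : Fin m) (x : E p) : E n :=
  WithLp.toLp 2 fun j : Fin n =>
    if h : n ≤ (j : ℕ) + p then x ⟨(j : ℕ) + p - n, by have := j.isLt; omega⟩
    else if (j : ℕ) = 0 then tstar m ((i : ℕ) + 1) else 0

/-- Long links `∐_1^m ℝ^p → ℝ^n`: smooth embeddings that map the open cubes `(-1,1)^p` into
`(-1,1)^n` and agree with the standard link outside of the open cubes. -/
structure IsLongLink (m p n : ℕ) (f : Fin m → E p → E n) : Prop where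
  smooth : ∀ i, ContDiff ℝ ∞ (f i)
  immersion : ∀ i x, Function.Injective (fderiv ℝ (f i) x)
  embedding : IsEmbedding (fun q : (_ : Fin m) × E p => f q.1 q.2)
  cube : ∀ i x, (∀ j, |x j| < 1) → ∀ j, |f i x j| < 1
  std : ∀ i x, ¬ (∀ j, |x j| < 1) → f i x = stdLink m p n i x

/-- The space `𝓛_{m·p}^n` of long links. -/
structure LongLink (m p n : ℕ) where
  toFun : Fin m → E p → E n
  isLongLink : IsLongLink m p n toFun

/-- A component of a long link. -/
def LongLink.component {m p n : ℕ} (i : Fin m) (f : LongLink m p n) : SmoothMap (E p) (E n) :=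
  ⟨f.toFun i, f.isLongLink.smooth i⟩

instance (m p n : ℕ) : TopologicalSpace (LongLink m p n) :=
  ⨅ i : Fin m, TopologicalSpace.induced (LongLink.component i) inferInstance

/-- The space `Ω 𝓛_{m·p}^n` of smooth loops in `𝓛_{m·p}^n`: smooth families, parametrized by `ℝ`,
that are constant at the standard link outside of `[-1,1]`. -/
structure LoopLink (m p n : ℕ) where
  link : ℝ → LongLink m p n
  smooth : ∀ i, ContDiff ℝ ∞ (fun q : ℝ × E p => (link q.1).toFun i q.2)
  based : ∀ t, t ∉ Icc (-1 : ℝ) 1 → (link t).toFun = stdLink m p n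

/-- A component of a loop of long links, as a smooth map `ℝ × ℝ^p → ℝ^n`. -/
def LoopLink.component {m p n : ℕ} (i : Fin m) (l : LoopLink m p n) :
    SmoothMap (ℝ × E p) (E n) :=
  ⟨fun q => (l.link q.1).toFun i q.2, l.smooth i⟩

instance (m p n : ℕ) : TopologicalSpace (LoopLink m p n) :=
  ⨅ i : Fin m, TopologicalSpace.induced (LoopLink.component i) inferInstance

/-! ### Graphing -/

/-- The graphing map:
`G(ω)_i (x_1, …, x_{p+1}) = (ω_i(x_{p+1})(x_1, …, x_p), x_{p+1})`. -/
def graphFun {m p n : ℕ} (l : LoopLink m p n) (i : Fin m) (x : E (p + 1)) : E (n + 1) :=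
  WithLp.toLp 2 (Fin.snoc (α := fun _ => ℝ)
    (fun j : Fin n =>
      (l.link (x (Fin.last p))).toFun i (WithLp.toLp 2 fun a : Fin p => x a.castSucc) j)
    (x (Fin.last p)))

/-! ### Joining the last two components -/

/-- The point `(a, 0, …, 0, y)` of `ℝ^{c+1}`. For `a = t_i^*` and `y ∈ ℝ` these points form the
`i`-th component of the standard link of one-dimensional components in `ℝ^{c+1}`. -/
def linePoint (c : ℕ) (a y : ℝ) : E (c + 1) :=
  WithLp.toLp 2 fun j : Fin (c + 1) =>
    if (j : ℕ) = c then y else if (j : ℕ) = 0 then a else 0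

/-- The vector `(0, …, 0, w)` of `ℝ^c`. -/
def axis (c : ℕ) (w : ℝ) : E c :=
  WithLp.toLp 2 fun j : Fin c => if (j : ℕ) + 1 = c then w else 0

/-- The box `[-1,1] × [-2k,2k]^c` in `ℝ^{c+1}`. -/
def box (c : ℕ) (k : ℝ) : Set (E (c + 1)) :=
  {x | ∀ j : Fin (c + 1), if (j : ℕ) = 0 then |x j| ≤ 1 else |x j| ≤ 2 * k}

/-- The block `[-1, t_{m-1}^* + ε] × [-1,1]^c` in `ℝ^{c+1}`. -/
def block (m c : ℕ) (ε : ℝ) : Set (E (c + 1)) :=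
  {x | (∀ j, |x j| ≤ 1) ∧ x 0 ≤ tstar m (m - 1) + ε}

/-- The first `m - 1` components of the standard link of one-dimensional components in
`ℝ^{c+1}`. -/
def lines (m c : ℕ) : Set (E (c + 1)) :=
  {x | ∃ i : ℕ, 1 ≤ i ∧ i ≤ m - 1 ∧ ∃ y : ℝ, x = linePoint c (tstar m i) y}

/-- The strip swept out, in framing coordinates, by `[0,1] × 0^{c-1} × [-1,1]`. -/
def strip {c : ℕ} (frame : ℝ × E c → E (c + 1)) : Set (E (c + 1)) :=
  {x | ∃ u ∈ Icc (0 : ℝ) 1, ∃ w ∈ Icc (-1 : ℝ) 1, x = frame (u, axis c w)}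

/-- The auxiliary data for joining the last two of `m` components of codimension `c`. -/
structure JoiningData (m c : ℕ) where
  ε : ℝ
  ε_pos : 0 < ε
  ε_lt : ε < 1 / (m : ℝ)
  k : ℝ
  two_lt_k : 2 < k
  /-- The framed tubular neighbourhood of the path `γ u = frame (u, 0)`, `0 ≤ u ≤ 1`, as a smooth
  coordinate system of `ℝ^{c+1}`: the first coordinate is the parameter of the path, the other `c`
  are the coordinates given by the framing. -/
  frame : OpenPartialHomeomorph (ℝ × E c) (E (c + 1))
  frame_smooth : ContDiffOn ℝ ∞ frame frame.source
  frame_symm_smooth : ContDiffOn ℝ ∞ frame.symm frame.target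
  /-- In the framing coordinates the tubular neighbourhood has radius `1 + ε`. -/
  tube_source : Icc (0 : ℝ) 1 ×ˢ Metric.closedBall (0 : E c) (1 + ε) ⊆ frame.source
  /-- The points within `ε` of the strip lie in the domain of the coordinate system. -/
  near_target : Metric.cthickening ε (strip frame) ⊆ frame.target
  /-- The framing over the initial point `P = (t_m^*, 0, …, 0)` of the path. -/
  frame_start : ∀ w ∈ Icc (-1 : ℝ) 1, frame (0, axis c w) = linePoint c (tstar m m) w
  /-- The framing over the final point `Q = (t_{m-1}^*, 0, …, 0, k)` of the path. -/
  frame_end : ∀ w ∈ Icc (-1 : ℝ) 1,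
    frame (1, axis c w) = linePoint c (tstar m (m - 1)) (k + w)
  /-- The velocity of the path at both ends is orthogonal to the last coordinate axis. -/
  velocity_start : deriv (fun u : ℝ => frame (u, 0) (Fin.last c)) 0 = 0
  velocity_end : deriv (fun u : ℝ => frame (u, 0) (Fin.last c)) 1 = 0
  /-- The interior of the tubular neighbourhood lies in the box and misses the block and the first
  `m - 1` standard components. -/
  tube_subset : frame '' (Ioo (0 : ℝ) 1 ×ˢ Metric.ball (0 : E c) (1 + ε)) ⊆
    box c k \ (block m c ε ∪ lines m c)
  /-- The points within `ε` of the strip lie in the box and miss the block. -/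
  near_subset : Metric.cthickening ε (strip frame) ⊆ box c k \ block m c ε
  /-- A line of constant framing coordinates that meets the cube `[-1,1]^{c+1}` (close to the
  strip) can meet the first `m - 1` standard components (close to the strip) only over the end
  point of the path, and then it is one of the lines that make up the strip. -/
  clean : ∀ (u u' : ℝ) (v : E c), (u, v) ∈ frame.source → (u', v) ∈ frame.source →
    frame (u, v) ∈ Metric.cthickening ε (strip frame) → (∀ j, |frame (u, v) j| ≤ 1) →
    frame (u', v) ∈ Metric.cthickening ε (strip frame) → frame (u', v) ∈ lines m c →
    u' = 1 ∧ ∃ w ∈ Icc (-1 : ℝ) 1, v = axis c w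
  /-- The diffeotopy `φ_s`, `0 ≤ s ≤ 1`. -/
  φ : ℝ → E (c + 1) → E (c + 1)
  φ_smooth : ContDiffOn ℝ ∞ (fun q : ℝ × E (c + 1) => φ q.1 q.2) (Icc (0 : ℝ) 1 ×ˢ univ)
  φ_diffeo : ∀ s ∈ Icc (0 : ℝ) 1, ∃ ψ : E (c + 1) → E (c + 1), ContDiff ℝ ∞ ψ ∧
    Function.LeftInverse ψ (φ s) ∧ Function.RightInverse ψ (φ s)
  φ_zero : ∀ x, φ 0 x = x
  /-- On the strip, `φ_s` flows along the path. -/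
  φ_strip : ∀ u s w : ℝ, 0 ≤ u → 0 ≤ s → u + s ≤ 1 → w ∈ Icc (-1 : ℝ) 1 →
    φ s (frame (u, axis c w)) = frame (u + s, axis c w)
  /-- `φ_s` is supported within `ε` of the strip. -/
  φ_support : ∀ s ∈ Icc (0 : ℝ) 1, ∀ x ∉ Metric.cthickening ε (strip frame), φ s x = x
  /-- Within `ε` of the strip, `φ_s` interpolates between the flow along the path and the
  identity: it preserves the framing coordinates and moves forward by at most `s`. -/
  φ_near : ∀ s ∈ Icc (0 : ℝ) 1, ∀ (u : ℝ) (v : E c), (u, v) ∈ frame.source →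
    frame (u, v) ∈ Metric.cthickening ε (strip frame) →
    ∃ u' ∈ Icc u (u + s), (u', v) ∈ frame.source ∧ φ s (frame (u, v)) = frame (u', v)
  /-- The rescaling of the first coordinate: an increasing diffeomorphism of `ℝ` that maps `(-1,1)`
  into itself and carries the positions of the first `m - 1` of `m` standard components to those
  of the `m - 1` standard components. -/
  S : ℝ → ℝ
  S_smooth : ContDiff ℝ ∞ S
  S_deriv : ∀ x, 0 < deriv S x
  S_surjective : Function.Surjective S
  S_maps : MapsTo S (Ioo (-1) 1) (Ioo (-1) 1)
  S_std : ∀ i : ℕ, 1 ≤ i → i ≤ m - 1 → S (tstar m i) = tstar (m - 1) i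

/-- `φ × 1 : ℝ^n → ℝ^n`, with `φ` acting on the first `a` coordinates. -/
def prodId {a n : ℕ} (h : a ≤ n) (φ : E a → E a) (y : E n) : E n :=
  WithLp.toLp 2 fun j : Fin n =>
    if hj : (j : ℕ) < a then φ (WithLp.toLp 2 fun l : Fin a => y (Fin.castLE h l)) ⟨j, hj⟩
    else y j

/-- The affine map `T`: subtract `k` from the first coordinate. It takes
`[k-1,k+1] × [-1,1]^{p-1}` onto `[-1,1]^p`. -/
def shift {p : ℕ} (k : ℝ) (x : E p) : E p :=
  WithLp.toLp 2 fun j : Fin p => if (j : ℕ) = 0 then x j - k else x j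

/-- The map `r × 1_{p-1} : ℝ^p → ℝ^p`. -/
def stretch {p : ℕ} (r : ℝ) (x : E p) : E p :=
  WithLp.toLp 2 fun j : Fin p => if (j : ℕ) = 0 then r * x j else x j

/-- The map `(S, 1/r, …, 1/r) × 1 : ℝ^n → ℝ^n`, with `c` factors `1/r`. -/
def shrink {n : ℕ} (c : ℕ) (S : ℝ → ℝ) (r : ℝ) (y : E n) : E n :=
  WithLp.toLp 2 fun j : Fin n =>
    if (j : ℕ) = 0 then S (y j) else if (j : ℕ) < c + 1 then y j / r else y j

open Classical in
/-- The first step of joining: `(φ_1 × 1) ∘ f` on the cubes `[-1,1]^p`; on the last of the `m - 1`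
copies of `ℝ^p` moreover `(φ_1 × 1) ∘ f_m ∘ T` on `[k-1,k+1] × [-1,1]^{p-1}`; and the standard
link `e^m` elsewhere. -/
def joinStep {m c p n : ℕ} (D : JoiningData m c) (h : c + 1 ≤ n) (f : Fin m → E p → E n)
    (i : Fin (m - 1)) (x : E p) : E n :=
  if ∀ j, |x j| ≤ 1 then
    prodId h (D.φ 1) (f (Fin.castLE (Nat.sub_le m 1) i) x)
  else if (i : ℕ) + 1 = m - 1 ∧ ∀ j, |shift D.k x j| ≤ 1 then
    prodId h (D.φ 1) (f ⟨m - 1, by have := i.isLt; omega⟩ (shift D.k x))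
  else stdLink m p n (Fin.castLE (Nat.sub_le m 1) i) x

/-- The joining map `J` on underlying maps. -/
def joinFun {m c p n : ℕ} (D : JoiningData m c) (h : c + 1 ≤ n) (f : Fin m → E p → E n)
    (i : Fin (m - 1)) (x : E p) : E n :=
  shrink c D.S (2 * D.k) (joinStep D h f i (stretch (2 * D.k) x))

end LongLinks

end

noncomputable section

namespace LongLinks

/-! ### Continuity of operations on spaces of smooth maps -/

namespace SmoothMap

variable {U V W : Type} [NormedAddCommGroup U] [NormedSpace ℝ U]
  [NormedAddCommGroup V] [NormedSpace ℝ V] [NormedAddCommGroup W] [NormedSpace ℝ W]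

/-! Commutation is strict, and almost formal. Joining acts by `φ_1` and the rescalings on the first
`c + 1` coordinates of the target, and by a shift and a stretch on the first coordinate of the
source. Since `p ≥ 1`, the coordinate added by graphing is touched by none of these, so joining a
graph is joining at each time separately.

The work lies in showing that the maps exist and are continuous. The definition of `J` by cases is
replaced by a sum (`joinStep_eq_joinSum`): a standard component plus differences `(φ_1 × 1) ∘ f -
(φ_1 × 1) ∘ e`, which vanish outside two disjoint cubes. The two agree because `φ_1` fixes the short
segments of the first `m - 1` lines and carries that of the last line to a segment of the line
before it. The sum is visibly smooth. It is built from `f` by composition, addition and subtraction,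
and these are continuous for the `C^∞` topology, composition by the Faà di Bruno formula
(`SmoothMap.continuous_comp`).

The join is an immersion because `φ_1` is a diffeomorphism and the derivatives of the differences
vanish off the open cubes. It is injective because the image of a cube under `φ_1` meets the
standard lines only where expected (`of_φ_one_eq_linePoint`). It stays in the cube because `φ_1`
preserves an open box (`φ_one_openBox`). An injective map that is standard outside a cube is proper,
hence an embedding (`isEmbedding_of_std`). -/

theorem continuous_jet (k : ℕ) : Continuous (SmoothMap.jet k : SmoothMap V W → _) :=
  continuous_iInf_dom continuous_induced_dom

/-- The derivatives of a smooth map depend continuously on the map and the point. -/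
theorem continuous_iteratedFDeriv [LocallyCompactSpace V] (k : ℕ) :
    Continuous fun q : SmoothMap V W × V => iteratedFDeriv ℝ k q.1.toFun q.2 :=
  -- Evaluation is jointly continuous for the compact-open topology because `V` is locally compact.
  ((continuous_jet k).comp continuous_fst).eval continuous_snd

theorem continuous_eval [LocallyCompactSpace V] :
    Continuous fun q : SmoothMap V W × V => q.1.toFun q.2 := by
  have h := (continuousMultilinearCurryFin0 ℝ V W).continuous.comp
    (continuous_iteratedFDeriv (V := V) (W := W) 0)
  refine h.congr fun q => ?_
  simp

/-- A family of smooth maps is continuous if all its derivatives are jointly continuous. -/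
theorem continuous_of_iteratedFDeriv {X : Type*} [TopologicalSpace X] {F : X → SmoothMap V W}
    (h : ∀ k : ℕ, Continuous fun q : X × V => iteratedFDeriv ℝ k (F q.1).toFun q.2) :
    Continuous F := by
  refine continuous_iInf_rng.2 fun k => continuous_induced_rng.2 ?_
  exact ContinuousMap.continuous_of_continuous_uncurry _ (h k)

/-- Composition of smooth maps. -/
def comp (g : SmoothMap V W) (f : SmoothMap U V) : SmoothMap U W :=
  ⟨g.toFun ∘ f.toFun, g.smooth.comp f.smooth⟩

/-- Pointwise sum of smooth maps. -/
def add (f g : SmoothMap V W) : SmoothMap V W :=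
  ⟨f.toFun + g.toFun, f.smooth.add g.smooth⟩

/-- Pointwise difference of smooth maps. -/
def sub (f g : SmoothMap V W) : SmoothMap V W :=
  ⟨f.toFun - g.toFun, f.smooth.sub g.smooth⟩

variable {X : Type*} [TopologicalSpace X]

/-- By the Faà di Bruno formula, each derivative of the composite is a finite sum of multilinear
expressions in derivatives of the two factors, and these are jointly continuous in the maps and the
point. -/
theorem continuous_comp [LocallyCompactSpace U] [LocallyCompactSpace V]
    {G : X → SmoothMap V W} {F : X → SmoothMap U V} (hG : Continuous G) (hF : Continuous F) :
    Continuous fun x => (G x).comp (F x) := by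
  refine continuous_of_iteratedFDeriv fun k => ?_
  have key : ∀ q : X × U, iteratedFDeriv ℝ k ((G q.1).comp (F q.1)).toFun q.2 =
      ∑ c : OrderedFinpartition k, c.compAlongOrderedFinpartitionL ℝ U V W
        (iteratedFDeriv ℝ c.length (G q.1).toFun ((F q.1).toFun q.2))
        fun i => iteratedFDeriv ℝ (c.partSize i) (F q.1).toFun q.2 := fun q =>
    iteratedFDeriv_comp (n := ∞) (G q.1).smooth.contDiffAt (F q.1).smooth.contDiffAt
      (by exact_mod_cast le_top)
  simp only [key]
  have hF' : Continuous fun q : X × U => (F q.1, q.2) :=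
    (hF.comp continuous_fst).prodMk continuous_snd
  have hev : Continuous fun q : X × U => (F q.1).toFun q.2 := continuous_eval.comp hF'
  refine continuous_finsetSum _ fun c _ => ?_
  have h1 : Continuous fun q : X × U => c.compAlongOrderedFinpartitionL ℝ U V W
      (iteratedFDeriv ℝ c.length (G q.1).toFun ((F q.1).toFun q.2)) :=
    (ContinuousLinearMap.continuous _).comp
      ((continuous_iteratedFDeriv c.length).comp ((hG.comp continuous_fst).prodMk hev))
  exact h1.eval (continuous_pi fun i => (continuous_iteratedFDeriv (c.partSize i)).comp hF')

theorem continuous_add [LocallyCompactSpace V] {F G : X → SmoothMap V W}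
    (hF : Continuous F) (hG : Continuous G) : Continuous fun x => (F x).add (G x) := by
  refine continuous_of_iteratedFDeriv fun k => ?_
  have key : ∀ q : X × V, iteratedFDeriv ℝ k ((F q.1).add (G q.1)).toFun q.2 =
      iteratedFDeriv ℝ k (F q.1).toFun q.2 + iteratedFDeriv ℝ k (G q.1).toFun q.2 := fun q =>
    iteratedFDeriv_add_apply ((F q.1).smooth.of_le (by exact_mod_cast le_top)).contDiffAt
      ((G q.1).smooth.of_le (by exact_mod_cast le_top)).contDiffAt
  simp only [key]
  exact ((continuous_iteratedFDeriv k).comp ((hF.comp continuous_fst).prodMk continuous_snd)).add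
    ((continuous_iteratedFDeriv k).comp ((hG.comp continuous_fst).prodMk continuous_snd))

theorem continuous_sub [LocallyCompactSpace V] {F G : X → SmoothMap V W}
    (hF : Continuous F) (hG : Continuous G) : Continuous fun x => (F x).sub (G x) := by
  refine continuous_of_iteratedFDeriv fun k => ?_
  have key : ∀ q : X × V, iteratedFDeriv ℝ k ((F q.1).sub (G q.1)).toFun q.2 =
      iteratedFDeriv ℝ k (F q.1).toFun q.2 - iteratedFDeriv ℝ k (G q.1).toFun q.2 := fun q =>
    iteratedFDeriv_sub_apply ((F q.1).smooth.of_le (by exact_mod_cast le_top)).contDiffAt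
      ((G q.1).smooth.of_le (by exact_mod_cast le_top)).contDiffAt
  simp only [key]
  exact ((continuous_iteratedFDeriv k).comp ((hF.comp continuous_fst).prodMk continuous_snd)).sub
    ((continuous_iteratedFDeriv k).comp ((hG.comp continuous_fst).prodMk continuous_snd))

end SmoothMap

theorem LongLink.continuous_component {m p n : ℕ} (i : Fin m) :
    Continuous (LongLink.component i : LongLink m p n → _) :=
  continuous_iInf_dom continuous_induced_dom

theorem LongLink.continuous_of_component {X : Type*} [TopologicalSpace X] {m p n : ℕ}
    {F : X → LongLink m p n} (h : ∀ i, Continuous fun x => LongLink.component i (F x)) :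
    Continuous F :=
  continuous_iInf_rng.2 fun i => continuous_induced_rng.2 (h i)

theorem LoopLink.continuous_component {m p n : ℕ} (i : Fin m) :
    Continuous (LoopLink.component i : LoopLink m p n → _) :=
  continuous_iInf_dom continuous_induced_dom

theorem LoopLink.continuous_of_component {X : Type*} [TopologicalSpace X] {m p n : ℕ}
    {F : X → LoopLink m p n} (h : ∀ i, Continuous fun x => LoopLink.component i (F x)) :
    Continuous F :=
  continuous_iInf_rng.2 fun i => continuous_induced_rng.2 (h i)

/-! ### The elementary maps -/

theorem contDiff_toLp {V : Type*} [NormedAddCommGroup V] [NormedSpace ℝ V] {n : ℕ}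
    {f : V → Fin n → ℝ} (h : ∀ j, ContDiff ℝ ∞ fun x => f x j) :
    ContDiff ℝ ∞ fun x => (WithLp.toLp 2 (f x) : E n) :=
  contDiff_euclidean.2 h

theorem contDiff_coord {n : ℕ} (j : Fin n) : ContDiff ℝ ∞ fun x : E n => x j :=
  contDiff_euclidean.1 contDiff_id j

theorem contDiff_stdLink (m p n : ℕ) (i : Fin m) : ContDiff ℝ ∞ (stdLink m p n i) := by
  refine contDiff_toLp fun j => ?_
  split_ifs
  exacts [contDiff_coord _, contDiff_const, contDiff_const]

/-- The first `a` coordinates. -/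
def head {a n : ℕ} (h : a ≤ n) (y : E n) : E a :=
  WithLp.toLp 2 fun l : Fin a => y (Fin.castLE h l)

theorem contDiff_head {a n : ℕ} (h : a ≤ n) : ContDiff ℝ ∞ (head h) :=
  contDiff_toLp fun _ => contDiff_coord _

theorem prodId_apply_of_lt {a n : ℕ} (h : a ≤ n) (φ : E a → E a) (y : E n) {j : Fin n}
    (hj : (j : ℕ) < a) : prodId h φ y j = φ (head h y) ⟨j, hj⟩ := by
  simp [prodId, hj, head]

theorem prodId_apply_of_le {a n : ℕ} (h : a ≤ n) (φ : E a → E a) (y : E n) {j : Fin n}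
    (hj : a ≤ (j : ℕ)) : prodId h φ y j = y j := by
  simp [prodId, not_lt.2 hj]

theorem head_prodId {a n : ℕ} (h : a ≤ n) (φ : E a → E a) (y : E n) :
    head h (prodId h φ y) = φ (head h y) := by
  ext l
  exact prodId_apply_of_lt h φ y (j := Fin.castLE h l) l.isLt

theorem contDiff_prodId {a n : ℕ} (h : a ≤ n) {φ : E a → E a} (hφ : ContDiff ℝ ∞ φ) :
    ContDiff ℝ ∞ (prodId h φ : E n → E n) := by
  refine contDiff_toLp fun j => ?_
  split_ifs with hj
  · exact (contDiff_coord _).comp (hφ.comp (contDiff_head h))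
  · exact contDiff_coord _

theorem prodId_leftInverse {a n : ℕ} (h : a ≤ n) {φ ψ : E a → E a}
    (hφ : Function.LeftInverse ψ φ) :
    Function.LeftInverse (prodId h ψ) (prodId h φ : E n → E n) := by
  intro y
  ext j
  rcases lt_or_ge (j : ℕ) a with hj | hj
  · rw [prodId_apply_of_lt h _ _ hj, head_prodId, hφ]
    rfl
  · rw [prodId_apply_of_le h _ _ hj, prodId_apply_of_le h _ _ hj]

theorem contDiff_shift {p : ℕ} (k : ℝ) : ContDiff ℝ ∞ (shift k : E p → E p) := by
  refine contDiff_toLp fun j => ?_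
  split_ifs
  exacts [(contDiff_coord j).sub contDiff_const, contDiff_coord j]

theorem shift_leftInverse {p : ℕ} (k : ℝ) :
    Function.LeftInverse (shift (-k)) (shift k : E p → E p) := by
  intro x
  ext j
  by_cases hj : (j : ℕ) = 0 <;> simp [shift, hj]

theorem contDiff_stretch {p : ℕ} (r : ℝ) : ContDiff ℝ ∞ (stretch r : E p → E p) := by
  refine contDiff_toLp fun j => ?_
  split_ifs
  exacts [contDiff_const.mul (contDiff_coord j), contDiff_coord j]

theorem stretch_leftInverse {p : ℕ} {r : ℝ} (hr : r ≠ 0) :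
    Function.LeftInverse (stretch r⁻¹) (stretch r : E p → E p) := by
  intro x
  ext j
  by_cases hj : (j : ℕ) = 0 <;> simp [stretch, hj, hr]

theorem contDiff_shrink {n : ℕ} (c : ℕ) {S : ℝ → ℝ} (hS : ContDiff ℝ ∞ S) (r : ℝ) :
    ContDiff ℝ ∞ (shrink c S r : E n → E n) := by
  refine contDiff_toLp fun j => ?_
  split_ifs
  exacts [hS.comp (contDiff_coord j), (contDiff_coord j).div_const r, contDiff_coord j]

theorem shrink_injective {n c : ℕ} {S : ℝ → ℝ} (hS : Function.Injective S) {r : ℝ}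
    (hr : r ≠ 0) : Function.Injective (shrink c S r : E n → E n) := by
  intro x y h
  ext j
  have hj : shrink c S r x j = shrink c S r y j := by rw [h]
  simp only [shrink] at hj
  split_ifs at hj
  · exact hS hj
  · field_simp at hj
    exact hj
  · exact hj

/-- By the chain rule, the derivative of `g` is a left inverse of the derivative of `f`. -/
theorem injective_fderiv_of_leftInverse {V W : Type*} [NormedAddCommGroup V] [NormedSpace ℝ V]
    [NormedAddCommGroup W] [NormedSpace ℝ W] {f : V → W} {g : W → V}
    (hg : ContDiff ℝ ∞ g) (hf : ContDiff ℝ ∞ f) (h : Function.LeftInverse g f) (x : V) :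
    Function.Injective (fderiv ℝ f x) := by
  have hc : fderiv ℝ (g ∘ f) x = (fderiv ℝ g (f x)).comp (fderiv ℝ f x) :=
    fderiv_comp x (hg.differentiable (by simp) _) (hf.differentiable (by simp) _)
  rw [h.comp_eq_id, fderiv_id] at hc
  intro a b hab
  have ha := DFunLike.congr_fun hc a
  have hb := DFunLike.congr_fun hc b
  simp only [ContinuousLinearMap.comp_apply, ContinuousLinearMap.id_apply] at ha hb
  rw [ha, hb, hab]

theorem injective_fderiv_comp {U V W : Type*} [NormedAddCommGroup U] [NormedSpace ℝ U]
    [NormedAddCommGroup V] [NormedSpace ℝ V]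
    [NormedAddCommGroup W] [NormedSpace ℝ W] {g : V → W} {f : U → V}
    (hg : ContDiff ℝ ∞ g) (hf : ContDiff ℝ ∞ f) (x : U)
    (hgi : Function.Injective (fderiv ℝ g (f x))) (hfi : Function.Injective (fderiv ℝ f x)) :
    Function.Injective (fderiv ℝ (fun y => g (f y)) x) := by
  have hc : fderiv ℝ (g ∘ f) x = (fderiv ℝ g (f x)).comp (fderiv ℝ f x) :=
    fderiv_comp x (hg.differentiable (by simp) _) (hf.differentiable (by simp) _)
  change Function.Injective (fderiv ℝ (g ∘ f) x)
  rw [hc]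
  exact hgi.comp hfi

theorem fderiv_apply_coord {V : Type*} [NormedAddCommGroup V] [NormedSpace ℝ V] {n : ℕ}
    {f : V → E n} (hf : ContDiff ℝ ∞ f) (x v : V) (j : Fin n) :
    fderiv ℝ f x v j = fderiv ℝ (fun y => f y j) x v := by
  have h := (hf.differentiable (by simp) x).hasFDerivAt
  have h' := (EuclideanSpace.proj j : E n →L[ℝ] ℝ).hasFDerivAt.comp x h
  exact (DFunLike.congr_fun h'.fderiv v).symm

/-- The derivative is diagonal, with nonzero entries `S'`, `1/r` and `1`; smoothness of the inverse
of `S` is not needed. -/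
theorem injective_fderiv_shrink {n c : ℕ} {S : ℝ → ℝ} (hS : ContDiff ℝ ∞ S)
    (hS' : ∀ x, 0 < deriv S x) {r : ℝ} (hr : r ≠ 0) (y : E n) :
    Function.Injective (fderiv ℝ (shrink c S r) y) := by
  rw [injective_iff_map_eq_zero]
  intro v hv
  ext j
  have hj : fderiv ℝ (shrink c S r) y v j = 0 := by rw [hv]; rfl
  rw [fderiv_apply_coord (contDiff_shrink c hS r)] at hj
  have hc : HasFDerivAt (fun z : E n => z j) (EuclideanSpace.proj j : E n →L[ℝ] ℝ) y :=
    (EuclideanSpace.proj j : E n →L[ℝ] ℝ).hasFDerivAt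
  by_cases h0 : (j : ℕ) = 0
  · simp only [shrink, h0, if_true] at hj
    have := ((hS.differentiable (by simp) (y j)).hasDerivAt.comp_hasFDerivAt y hc).fderiv
    simp only [Function.comp_def] at this
    rw [this] at hj
    simpa [(hS' (y j)).ne'] using hj
  · by_cases h1 : (j : ℕ) < c + 1
    · simp only [shrink, h0, h1, if_true, if_false, div_eq_mul_inv] at hj
      rw [(hc.mul_const r⁻¹).fderiv] at hj
      simpa [hr] using hj
    · simp only [shrink, h0, h1, if_false] at hj
      rw [hc.fderiv] at hj
      simpa using hj

/-- The last `p` coordinates. -/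
def tail {p n : ℕ} (h : p ≤ n) (y : E n) : E p :=
  WithLp.toLp 2 fun l : Fin p => y ⟨(l : ℕ) + (n - p), by omega⟩

theorem contDiff_tail {p n : ℕ} (h : p ≤ n) : ContDiff ℝ ∞ (tail h) :=
  contDiff_toLp fun _ => contDiff_coord _

/-- This left inverse yields injectivity, the immersion property and properness of the standard
components. -/
theorem tail_stdLink {m p n : ℕ} (h : p ≤ n) (i : Fin m) :
    Function.LeftInverse (tail h) (stdLink m p n i) := by
  intro x
  ext l
  have h1 : n ≤ (l : ℕ) + (n - p) + p := by omega
  have h2 : (l : ℕ) + (n - p) + p - n = l := by omega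
  simp [tail, stdLink, h1, h2]

theorem injective_fderiv_stdLink {m p n : ℕ} (h : p ≤ n) (i : Fin m) (x : E p) :
    Function.Injective (fderiv ℝ (stdLink m p n i) x) :=
  injective_fderiv_of_leftInverse (contDiff_tail h) (contDiff_stdLink m p n i)
    (tail_stdLink h i) x

theorem norm_tail_le {p n : ℕ} (h : p ≤ n) (y : E n) : ‖tail h y‖ ≤ ‖y‖ := by
  rw [EuclideanSpace.norm_eq, EuclideanSpace.norm_eq]
  refine Real.sqrt_le_sqrt ?_
  let e : Fin p ↪ Fin n := ⟨fun l => ⟨(l : ℕ) + (n - p), by omega⟩, fun a b hab => by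
    simpa [Fin.ext_iff] using hab⟩
  have : ∑ l, ‖tail h y l‖ ^ 2 = ∑ j ∈ Finset.univ.map e, ‖y j‖ ^ 2 := by
    rw [Finset.sum_map]; rfl
  rw [this]
  exact Finset.sum_le_sum_of_subset_of_nonneg (Finset.subset_univ _) fun _ _ _ => by positivity

/-! ### Maps supported in the cube -/

/-- Let `r` decrease to `1`. This extends closed conditions known outside a closed box centred at
`0` to its boundary. -/
theorem mem_closure_of_forall_one_lt_smul {V : Type*} [NormedAddCommGroup V] [NormedSpace ℝ V]
    {s : Set V} {x : V} (h : ∀ r : ℝ, 1 < r → r • x ∈ s) : x ∈ closure s := by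
  have hl : Filter.Tendsto (fun r : ℝ => r • x) (𝓝[>] 1) (𝓝 x) := by
    have : Continuous fun r : ℝ => r • x := by fun_prop
    simpa using (this.tendsto 1).mono_left nhdsWithin_le_nhds
  exact mem_closure_of_tendsto hl (eventually_nhdsWithin_of_forall fun r hr => h r hr)

theorem isClosed_cube (n : ℕ) : IsClosed {x : E n | ∀ j, |x j| ≤ 1} := by
  simp only [ofPred_forall]
  exact isClosed_iInter fun j =>
    isClosed_le (contDiff_coord j).continuous.abs continuous_const

theorem isOpen_cube (n : ℕ) : IsOpen {x : E n | ∀ j, |x j| < 1} := by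
  simp only [ofPred_forall]
  exact isOpen_iInter_of_finite fun j =>
    isOpen_lt (contDiff_coord j).continuous.abs continuous_const

/-- The derivative of a smooth map that vanishes outside of the open cube vanishes there, too. -/
theorem fderiv_eq_zero_of_notMem_cube {p : ℕ} {W : Type*} [NormedAddCommGroup W]
    [NormedSpace ℝ W] {a : E p → W} (ha : ContDiff ℝ ∞ a)
    (h0 : ∀ x, ¬ (∀ j, |x j| < 1) → a x = 0) {x : E p} (hx : ¬ ∀ j, |x j| < 1) :
    fderiv ℝ a x = 0 := by
  have hcl : IsClosed {y | fderiv ℝ a y = 0} :=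
    isClosed_eq (ha.continuous_fderiv (by simp)) continuous_const
  have hsub : {y : E p | ∀ j, |y j| ≤ 1}ᶜ ⊆ {y | fderiv ℝ a y = 0} := by
    intro y hy
    have : a =ᶠ[𝓝 y] fun _ => 0 := by
      filter_upwards [(isClosed_cube p).isOpen_compl.mem_nhds hy] with z hz
      exact h0 z fun hz' => hz fun j => (hz' j).le
    rw [mem_ofPred_eq, this.fderiv_eq, fderiv_fun_const]
    rfl
  -- A point outside the open cube has a coordinate of absolute value at least `1`, so scaling by `r
  -- > 1` takes it out of the closed cube.
  refine closure_minimal hsub hcl (mem_closure_of_forall_one_lt_smul fun r hr hmem => hx ?_)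
  intro j
  have := hmem j
  rw [PiLp.smul_apply, smul_eq_mul, abs_mul, abs_of_pos (by linarith)] at this
  nlinarith [abs_nonneg (x j)]

/-- Injective maps that agree with the standard link outside of the cubes are embeddings. -/
theorem isEmbedding_of_std {m p n : ℕ} (hpn : p ≤ n) {f : Fin m → E p → E n}
    (hf : ∀ i, Continuous (f i))
    (hstd : ∀ i x, ¬ (∀ j, |x j| < 1) → f i x = stdLink m p n i x)
    (hinj : Function.Injective fun q : (_ : Fin m) × E p => f q.1 q.2) :
    IsEmbedding fun q : (_ : Fin m) × E p => f q.1 q.2 := by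
  -- Each component is proper: the standard component is, as its norm is at least `‖x‖` by
  -- `norm_tail_le`, and `f i` agrees with it off a compact cube.
  have hclosed : ∀ i, IsClosedMap (f i) := by
    intro i
    refine (isProperMap_iff_tendsto_cocompact.2 ⟨hf i, ?_⟩).isClosedMap
    have hs : Filter.Tendsto (stdLink m p n i) (Filter.cocompact _) (Filter.cocompact _) := by
      rw [← Metric.cobounded_eq_cocompact (α := E n), ← tendsto_norm_atTop_iff_cobounded]
      refine Filter.tendsto_atTop_mono (fun x => ?_) (tendsto_norm_cocompact_atTop (E := E p))
      have := norm_tail_le hpn (stdLink m p n i x)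
      rwa [tail_stdLink hpn i x] at this
    refine hs.congr' ?_
    have hc : IsCompact {x : E p | ∀ j, |x j| ≤ 1} := by
      refine Metric.isCompact_of_isClosed_isBounded (isClosed_cube p) ?_
      refine (Metric.isBounded_closedBall (x := (0 : E p)) (r := Real.sqrt p)).subset
        fun x hx => ?_
      rw [mem_closedBall_zero_iff, EuclideanSpace.norm_eq]
      refine Real.sqrt_le_sqrt ?_
      calc ∑ j, ‖x j‖ ^ 2 ≤ ∑ _j : Fin p, (1 : ℝ) :=
            Finset.sum_le_sum fun j _ => pow_le_one₀ (norm_nonneg _) (hx j)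
        _ = p := by simp
    filter_upwards [hc.compl_mem_cocompact] with x hx
    exact (hstd i x fun h => hx fun j => (h j).le).symm
  refine (IsClosedEmbedding.of_continuous_injective_isClosedMap
    (continuous_sigma hf) hinj fun C hC => ?_).isEmbedding
  have : (fun q : (_ : Fin m) × E p => f q.1 q.2) '' C = ⋃ i, f i '' (Sigma.mk (β := fun _ => E p) i ⁻¹' C) := by
    ext y
    simp only [mem_image, mem_iUnion, mem_preimage]
    constructor
    · rintro ⟨⟨i, x⟩, h, rfl⟩
      exact ⟨i, x, h, rfl⟩
    · rintro ⟨i, x, h, rfl⟩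
      exact ⟨⟨i, x⟩, h, rfl⟩
  rw [this]
  exact isClosed_iUnion_of_finite fun i => hclosed i _ (hC.preimage continuous_sigmaMk)

/-! ### Positions of the standard components -/

theorem abs_tstar_lt_one {m i : ℕ} (hi : 1 ≤ i) (him : i ≤ m) : |tstar m i| < 1 := by
  have h1 : (1 : ℝ) ≤ i := by exact_mod_cast hi
  have h2 : (i : ℝ) ≤ m := by exact_mod_cast him
  have h3 : (0 : ℝ) < (m : ℝ) + 1 := by positivity
  have h4 : 0 < 2 * (i : ℝ) / ((m : ℝ) + 1) := by positivity
  have h5 : 2 * (i : ℝ) / ((m : ℝ) + 1) < 2 := by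
    rw [div_lt_iff₀ h3]
    linarith
  rw [abs_lt]
  constructor <;> simp only [tstar] <;> linarith

theorem tstar_mono {m i j : ℕ} (h : i ≤ j) : tstar m i ≤ tstar m j := by
  unfold tstar
  gcongr

theorem tstar_injective (m : ℕ) : Function.Injective (tstar m) := by
  intro i j h
  have h3 : (m : ℝ) + 1 ≠ 0 := by positivity
  simp only [tstar] at h
  field_simp at h
  have : (i : ℝ) = j := by linarith
  exact_mod_cast this

theorem linePoint_last (c : ℕ) (a y : ℝ) : linePoint c a y (Fin.last c) = y := by
  simp [linePoint]

theorem linePoint_zero {c : ℕ} (hc : 1 ≤ c) (a y : ℝ) : linePoint c a y 0 = a := by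
  have : 0 ≠ c := by omega
  simp [linePoint, this]

theorem abs_linePoint_le {c : ℕ} {a y : ℝ} (ha : |a| ≤ 1) (hy : |y| ≤ 1) (j : Fin (c + 1)) :
    |linePoint c a y j| ≤ 1 := by
  simp only [linePoint]
  split_ifs <;> simp [ha, hy]

/-! ### The time-one map of the diffeotopy -/

namespace JoiningData

variable {m c : ℕ} (D : JoiningData m c)

theorem one_mem : (1 : ℝ) ∈ Icc (0 : ℝ) 1 := by simp

theorem contDiff_φ_one : ContDiff ℝ ∞ (D.φ 1) := by
  have h : ContDiff ℝ ∞ fun x : E (c + 1) => ((1 : ℝ), x) := contDiff_const.prodMk contDiff_id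
  exact contDiffOn_univ.1
    (D.φ_smooth.comp h.contDiffOn fun x _ => ⟨one_mem, mem_univ _⟩)

theorem φ_one_injective : Function.Injective (D.φ 1) := by
  obtain ⟨ψ, -, h, -⟩ := D.φ_diffeo 1 one_mem
  exact h.injective

theorem φ_one_mem_near {z : E (c + 1)} (hz : z ∈ Metric.cthickening D.ε (strip D.frame)) :
    D.φ 1 z ∈ Metric.cthickening D.ε (strip D.frame) := by
  by_contra h
  have := D.φ_one_injective (D.φ_support 1 one_mem _ h)
  rw [this] at h
  exact h hz

/-- The diffeotopy fixes the short segments of the first `m - 1` standard components. -/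
theorem φ_one_linePoint_of_le (hc : 1 ≤ c) {i : ℕ} (hi : 1 ≤ i) (him : i ≤ m - 1) {y : ℝ}
    (hy : |y| ≤ 1) : D.φ 1 (linePoint c (tstar m i) y) = linePoint c (tstar m i) y := by
  -- The segment lies in the block, which the support of the diffeotopy misses.
  refine D.φ_support 1 one_mem _ fun hN => (D.near_subset hN).2 ⟨fun j => ?_, ?_⟩
  · exact abs_linePoint_le (abs_tstar_lt_one hi (by omega)).le hy j
  · rw [linePoint_zero hc]
    have := tstar_mono (m := m) him
    linarith [D.ε_pos]

/-- The diffeotopy carries a segment of the last standard component to the component before. -/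
theorem φ_one_linePoint_last {w : ℝ} (hw : |w| ≤ 1) :
    D.φ 1 (linePoint c (tstar m m) w) = linePoint c (tstar m (m - 1)) (D.k + w) := by
  have hw' : w ∈ Icc (-1 : ℝ) 1 := abs_le.1 hw
  rw [← D.frame_start w hw', D.φ_strip 0 1 w le_rfl zero_le_one (by simp) hw', zero_add,
    D.frame_end w hw']

/-- The diffeotopy preserves the open box. -/
theorem φ_one_openBox {z : E (c + 1)}
    (hz : ∀ j : Fin (c + 1), |z j| < if (j : ℕ) = 0 then 1 else 2 * D.k) (j : Fin (c + 1)) :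
    |D.φ 1 z j| < if (j : ℕ) = 0 then 1 else 2 * D.k := by
  by_contra hj
  have hk := D.two_lt_k
  have hcl : IsClosed {x | D.φ 1 x = x} :=
    isClosed_eq D.contDiff_φ_one.continuous continuous_id
  have hsub : (Metric.cthickening D.ε (strip D.frame))ᶜ ⊆ {x | D.φ 1 x = x} :=
    fun x hx => D.φ_support 1 one_mem x hx
  have hmem : D.φ 1 z ∈ closure (Metric.cthickening D.ε (strip D.frame))ᶜ := by
    -- If the image point has left the open box, its multiples by `r > 1` lie outside the closed
    -- box, hence outside the support, and are fixed.
    refine mem_closure_of_forall_one_lt_smul fun r hr hN => hj ?_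
    have hb := (D.near_subset hN).1 j
    rw [PiLp.smul_apply, smul_eq_mul, abs_mul, abs_of_pos (by linarith : (0 : ℝ) < r)] at hb
    split_ifs at hb ⊢ <;> nlinarith [abs_nonneg (D.φ 1 z j)]
  have hfix : D.φ 1 (D.φ 1 z) = D.φ 1 z := closure_minimal hsub hcl hmem
  -- In the limit the image point is itself fixed, so by injectivity it equals `z`, which is in the
  -- open box.
  rw [D.φ_one_injective hfix] at hj
  exact hj (hz j)

/-- The image of the cube meets the first `m - 1` standard components only in the cube and in the
segment around the end point of the path. -/
theorem of_φ_one_eq_linePoint (hc : 1 ≤ c) {z : E (c + 1)} (hz : ∀ j, |z j| ≤ 1) {i : ℕ}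
    (hi : 1 ≤ i) (him : i ≤ m - 1) {y : ℝ} (h : D.φ 1 z = linePoint c (tstar m i) y) :
    |y| ≤ 1 ∨ (i = m - 1 ∧ |y - D.k| ≤ 1) := by
  by_cases hN : z ∈ Metric.cthickening D.ε (strip D.frame)
  · right
    set q := D.frame.symm z with hq
    have ht := D.near_target hN
    have hs : q ∈ D.frame.source := D.frame.map_target ht
    have hqz : D.frame (q.1, q.2) = z := D.frame.right_inv ht
    -- Inside the support, `φ_1` moves `z` along a line of constant framing coordinates `v`, so
    -- `clean` applies: the image lies in the end segment of the strip. Its first and last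
    -- coordinates then identify `i` and `y`.
    obtain ⟨u', -, hu', hφ⟩ := D.φ_near 1 one_mem q.1 q.2 hs (by rwa [hqz])
    rw [hqz] at hφ
    obtain ⟨rfl, w, hw, hv⟩ := D.clean q.1 u' q.2 hs hu' (by rwa [hqz]) (by rwa [hqz])
      (by rw [← hφ]; exact D.φ_one_mem_near hN) (by rw [← hφ]; exact ⟨i, hi, him, y, h⟩)
    rw [hv, D.frame_end w hw, h] at hφ
    have h0 := congrArg (fun x : E (c + 1) => x 0) hφ
    have hl := congrArg (fun x : E (c + 1) => x (Fin.last c)) hφ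
    simp only [linePoint_zero hc, linePoint_last] at h0 hl
    refine ⟨tstar_injective m h0, ?_⟩
    rw [hl, add_sub_cancel_left]
    exact abs_le.2 hw
  · left
    rw [D.φ_support 1 one_mem z hN] at h
    have := hz (Fin.last c)
    rwa [h, linePoint_last] at this

theorem S_injective : Function.Injective D.S := (strictMono_of_deriv_pos D.S_deriv).injective

end JoiningData

/-! ### Coordinates of the standard link -/

theorem ext_head {a n : ℕ} (h : a ≤ n) {y z : E n} (hh : head h y = head h z)
    (ht : ∀ j : Fin n, a ≤ (j : ℕ) → y j = z j) : y = z := by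
  ext j
  rcases lt_or_ge (j : ℕ) a with hj | hj
  · exact congrArg (fun x : E a => x ⟨j, hj⟩) hh
  · exact ht j hj

section Std

variable {m c p n : ℕ}

theorem head_stdLink (hn : n = c + p) (hp : 0 < p) (h : c + 1 ≤ n) (i : Fin m) (x : E p) :
    head h (stdLink m p n i x) = linePoint c (tstar m ((i : ℕ) + 1)) (x ⟨0, hp⟩) := by
  subst hn
  ext j
  have hj := j.isLt
  by_cases hjc : (j : ℕ) = c
  · simp [head, stdLink, linePoint, hjc]
  · have : ¬ c + p ≤ (j : ℕ) + p := by omega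
    simp [head, stdLink, linePoint, hjc, show ¬ c ≤ (j : ℕ) by omega]

theorem stdLink_apply_of_lt (hn : n = c + p) (i : Fin m) (x : E p) {j : Fin n}
    (hj : c < (j : ℕ)) : stdLink m p n i x j = x ⟨(j : ℕ) - c, by omega⟩ := by
  subst hn
  have h2 : (j : ℕ) + p - (c + p) = j - c := by omega
  simp [stdLink, hj.le, h2]

variable (D : JoiningData m c)

/-- Together with `prodId_stdLink_last` this makes the cases of `joinStep` fit together. Among the
`c + 1` coordinates on which `φ_1` acts, only coordinate `c` depends on `x`, and it is the first
coordinate of `x`. -/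
theorem prodId_stdLink_of_le (hn : n = c + p) (hp : 0 < p) (h : c + 1 ≤ n) (hc : 1 ≤ c)
    {i : Fin m} (hi : (i : ℕ) + 1 ≤ m - 1) {x : E p} (hx : |x ⟨0, hp⟩| ≤ 1) :
    prodId h (D.φ 1) (stdLink m p n i x) = stdLink m p n i x := by
  refine ext_head h ?_ fun j hj => prodId_apply_of_le h _ _ hj
  rw [head_prodId, head_stdLink hn hp, D.φ_one_linePoint_of_le hc (by omega) hi hx]

/-- The shift lowers the first coordinate by `k`, and `φ_1` raises it again while moving from the
last line to the one before. -/
theorem prodId_stdLink_last (hn : n = c + p) (hp : 0 < p) (h : c + 1 ≤ n)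
    {i i' : Fin m} (hi : (i : ℕ) + 1 = m) (hi' : (i' : ℕ) + 1 = m - 1) {x : E p}
    (hx : |x ⟨0, hp⟩ - D.k| ≤ 1) :
    prodId h (D.φ 1) (stdLink m p n i (shift D.k x)) = stdLink m p n i' x := by
  refine ext_head h ?_ fun j hj => ?_
  · rw [head_prodId, head_stdLink hn hp, head_stdLink hn hp, hi, hi']
    have : shift D.k x ⟨0, hp⟩ = x ⟨0, hp⟩ - D.k := by simp [shift]
    rw [this, D.φ_one_linePoint_last hx, add_sub_cancel]
  · rw [prodId_apply_of_le h _ _ hj, stdLink_apply_of_lt hn i _ (by omega),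
      stdLink_apply_of_lt hn i' _ (by omega)]
    have : (j : ℕ) - c ≠ 0 := by omega
    simp [shift, this]

/-! ### Joining as a sum -/

/-- The sum of a standard component and of two maps supported in disjoint cubes. It agrees with
`joinStep` on long links. -/
def joinSum (D : JoiningData m c) (h : c + 1 ≤ n) (f : Fin m → E p → E n)
    (i : Fin (m - 1)) (x : E p) : E n :=
  stdLink m p n (Fin.castLE (Nat.sub_le m 1) i) x +
    (prodId h (D.φ 1) (f (Fin.castLE (Nat.sub_le m 1) i) x) -
      prodId h (D.φ 1) (stdLink m p n (Fin.castLE (Nat.sub_le m 1) i) x)) +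
    if (i : ℕ) + 1 = m - 1 then
      prodId h (D.φ 1) (f ⟨m - 1, by have := i.isLt; omega⟩ (shift D.k x)) -
        prodId h (D.φ 1) (stdLink m p n ⟨m - 1, by have := i.isLt; omega⟩ (shift D.k x))
    else 0

/-- The cubes `|x₁| ≤ 1` and `|x₁ - k| < 1` are disjoint as `k > 2`, so at most one difference
survives at each point. Its subtracted standard term cancels the leading one. -/
theorem joinStep_eq_joinSum (hn : n = c + p) (hp : 0 < p) (h : c + 1 ≤ n) (hc : 1 ≤ c)
    {f : Fin m → E p → E n}
    (hf : ∀ i x, ¬ (∀ j, |x j| < 1) → f i x = stdLink m p n i x) (i : Fin (m - 1)) (x : E p) :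
    joinStep D h f i x = joinSum D h f i x := by
  have hk := D.two_lt_k
  have hs0 : shift D.k x ⟨0, hp⟩ = x ⟨0, hp⟩ - D.k := by simp [shift]
  have hi := i.isLt
  unfold joinStep joinSum
  split_ifs with h1 h3 h2 h3 h3
  · have hT : ¬ ∀ j, |shift D.k x j| < 1 := by
      intro h
      have h4 := h ⟨0, hp⟩
      have h5 := h1 ⟨0, hp⟩
      rw [hs0, abs_lt] at h4
      rw [abs_le] at h5
      linarith
    rw [hf _ _ hT, prodId_stdLink_of_le D hn hp h hc (by simp) (h1 ⟨0, hp⟩)]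
    simp
  · rw [prodId_stdLink_of_le D hn hp h hc (by simp) (h1 ⟨0, hp⟩)]
    simp
  · rw [hf (Fin.castLE _ i) x fun h => h1 fun j => (h j).le,
      prodId_stdLink_last D hn hp h (i := ⟨m - 1, by omega⟩) (by simp; omega)
        (i' := Fin.castLE (Nat.sub_le m 1) i) (by simpa using h2.1)
        (by rw [← hs0]; exact h2.2 _)]
    simp
  · exact absurd h2.1 h3
  · rw [hf (Fin.castLE _ i) x fun h => h1 fun j => (h j).le,
      hf _ (shift D.k x) fun h => h2 ⟨h3, fun j => (h j).le⟩]
    simp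
  · rw [hf (Fin.castLE _ i) x fun h => h1 fun j => (h j).le]
    simp

end Std

/-! ### Smooth dependence of the join -/

theorem SmoothMap.ext {V W : Type} [NormedAddCommGroup V] [NormedSpace ℝ V]
    [NormedAddCommGroup W] [NormedSpace ℝ W] {f g : SmoothMap V W}
    (h : ∀ x, f.toFun x = g.toFun x) : f = g := by
  cases f
  cases g
  congr
  exact funext h

section Join

variable {m c p n : ℕ} (D : JoiningData m c)

/-- The join of two components depending on parameters in `V`: here `X` gives the point of `ℝ^p`,
`f` is the component with index `i`, and `g` is the last component, composed with `shift`. -/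
def joinMap {V : Type} [NormedAddCommGroup V] [NormedSpace ℝ V] (h : c + 1 ≤ n)
    (i : Fin (m - 1)) (X : SmoothMap V (E p)) (f g : SmoothMap V (E n)) : SmoothMap V (E n) :=
  let P : SmoothMap (E n) (E n) := ⟨prodId h (D.φ 1), contDiff_prodId h D.contDiff_φ_one⟩
  let s (i : Fin m) : SmoothMap (E p) (E n) := ⟨stdLink m p n i, contDiff_stdLink m p n i⟩
  let T : SmoothMap (E p) (E p) := ⟨shift D.k, contDiff_shift D.k⟩
  let R : SmoothMap (E n) (E n) := ⟨shrink c D.S (2 * D.k), contDiff_shrink c D.S_smooth _⟩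
  let a := ((s (Fin.castLE (Nat.sub_le m 1) i)).comp X).add
    ((P.comp f).sub (P.comp ((s (Fin.castLE (Nat.sub_le m 1) i)).comp X)))
  if (i : ℕ) + 1 = m - 1 then
    R.comp (a.add ((P.comp g).sub
      (P.comp ((s ⟨m - 1, by have := i.isLt; omega⟩).comp (T.comp X)))))
  else R.comp a

theorem continuous_joinMap {V : Type} [NormedAddCommGroup V] [NormedSpace ℝ V]
    [LocallyCompactSpace V] (h : c + 1 ≤ n) (i : Fin (m - 1)) (X : SmoothMap V (E p))
    {Y : Type*} [TopologicalSpace Y] {f g : Y → SmoothMap V (E n)}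
    (hf : Continuous f) (hg : Continuous g) :
    Continuous fun y => joinMap D h i X (f y) (g y) := by
  unfold joinMap
  dsimp only
  split_ifs
  · exact SmoothMap.continuous_comp continuous_const (SmoothMap.continuous_add
      (SmoothMap.continuous_add continuous_const (SmoothMap.continuous_sub
        (SmoothMap.continuous_comp continuous_const hf) continuous_const))
      (SmoothMap.continuous_sub (SmoothMap.continuous_comp continuous_const hg) continuous_const))
  · exact SmoothMap.continuous_comp continuous_const
      (SmoothMap.continuous_add continuous_const (SmoothMap.continuous_sub
        (SmoothMap.continuous_comp continuous_const hf) continuous_const))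

/-- The hypotheses concern the single point `v`, so `F` may depend on it; for a loop it is the link
at the time of `v`. -/
theorem joinMap_apply {V : Type} [NormedAddCommGroup V] [NormedSpace ℝ V] (h : c + 1 ≤ n)
    (i : Fin (m - 1)) (X : SmoothMap V (E p)) (f g : SmoothMap V (E n)) (v : V)
    {F : Fin m → E p → E n}
    (hf : f.toFun v = F (Fin.castLE (Nat.sub_le m 1) i) (X.toFun v))
    (hg : g.toFun v = F ⟨m - 1, by have := i.isLt; omega⟩ (shift D.k (X.toFun v))) :
    (joinMap D h i X f g).toFun v = shrink c D.S (2 * D.k) (joinSum D h F i (X.toFun v)) := by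
  unfold joinMap joinSum
  dsimp only
  split_ifs <;> simp [SmoothMap.comp, SmoothMap.add, SmoothMap.sub, hf, hg]

theorem joinFun_eq (hn : n = c + p) (hp : 0 < p) (h : c + 1 ≤ n) (hc : 1 ≤ c)
    {f : Fin m → E p → E n}
    (hf : ∀ i x, ¬ (∀ j, |x j| < 1) → f i x = stdLink m p n i x) (i : Fin (m - 1)) (x : E p) :
    joinFun D h f i x = shrink c D.S (2 * D.k) (joinSum D h f i (stretch (2 * D.k) x)) := by
  rw [joinFun, joinStep_eq_joinSum D hn hp h hc hf]

theorem contDiff_joinSum (h : c + 1 ≤ n) {f : Fin m → E p → E n} (hf : ∀ i, ContDiff ℝ ∞ (f i))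
    (i : Fin (m - 1)) : ContDiff ℝ ∞ (joinSum D h f i) := by
  have hP := contDiff_prodId h D.contDiff_φ_one
  refine ((contDiff_stdLink m p n _).add ((hP.comp (hf _)).sub
    (hP.comp (contDiff_stdLink m p n _)))).add ?_
  split_ifs
  · exact (hP.comp ((hf _).comp (contDiff_shift _))).sub
      (hP.comp ((contDiff_stdLink m p n _).comp (contDiff_shift _)))
  · exact contDiff_const

/-! ### The join of a long link is a long link -/

theorem injective_fderiv_prodId (h : c + 1 ≤ n) (y : E n) :
    Function.Injective (fderiv ℝ (prodId h (D.φ 1)) y) := by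
  obtain ⟨ψ, hψ, hl, -⟩ := D.φ_diffeo 1 JoiningData.one_mem
  exact injective_fderiv_of_leftInverse (contDiff_prodId h hψ)
    (contDiff_prodId h D.contDiff_φ_one) (prodId_leftInverse h hl) y

theorem prodId_injective (h : c + 1 ≤ n) :
    Function.Injective (prodId h (D.φ 1) : E n → E n) := by
  obtain ⟨ψ, -, hl, -⟩ := D.φ_diffeo 1 JoiningData.one_mem
  exact (prodId_leftInverse h hl).injective

/-- Inside either open cube the map is locally a composite of immersions. Elsewhere, boundaries
included, the differences have derivative zero and the derivative is that of the standard component.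
-/
theorem injective_fderiv_joinSum (hn : n = c + p) (hp : 0 < p) (h : c + 1 ≤ n) (hc : 1 ≤ c)
    {f : Fin m → E p → E n} (hf : IsLongLink m p n f) (i : Fin (m - 1)) (x : E p) :
    Function.Injective (fderiv ℝ (joinSum D h f i) x) := by
  have hk := D.two_lt_k
  have hP := contDiff_prodId h D.contDiff_φ_one
  have hT := contDiff_shift (p := p) D.k
  by_cases h1 : ∀ j, |x j| < 1
  · have he : joinSum D h f i =ᶠ[𝓝 x]
        fun y => prodId h (D.φ 1) (f (Fin.castLE (Nat.sub_le m 1) i) y) := by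
      filter_upwards [(isOpen_cube p).mem_nhds h1] with y hy
      rw [← joinStep_eq_joinSum D hn hp h hc hf.std, joinStep, if_pos fun j => (hy j).le]
    rw [he.fderiv_eq]
    exact injective_fderiv_comp hP (hf.smooth _) x (injective_fderiv_prodId D h _)
      (hf.immersion _ x)
  by_cases h2 : (i : ℕ) + 1 = m - 1 ∧ ∀ j, |shift D.k x j| < 1
  · have he : joinSum D h f i =ᶠ[𝓝 x] fun y => prodId h (D.φ 1)
        (f ⟨m - 1, by have := i.isLt; omega⟩ (shift D.k y)) := by
      filter_upwards [((isOpen_cube p).preimage hT.continuous).mem_nhds h2.2] with y hy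
      have hy1 : ¬ ∀ j, |y j| ≤ 1 := by
        intro hy1
        have h4 := hy ⟨0, hp⟩
        have h5 := hy1 ⟨0, hp⟩
        simp only [shift, if_true] at h4
        rw [abs_lt] at h4
        rw [abs_le] at h5
        linarith
      rw [← joinStep_eq_joinSum D hn hp h hc hf.std, joinStep, if_neg hy1,
        if_pos ⟨h2.1, fun j => (hy j).le⟩]
    rw [he.fderiv_eq]
    exact injective_fderiv_comp hP ((hf.smooth _).comp hT) x (injective_fderiv_prodId D h _)
      (injective_fderiv_comp (hf.smooth _) hT x (hf.immersion _ _)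
        (injective_fderiv_of_leftInverse (contDiff_shift _) hT (shift_leftInverse _) x))
  have hb : ∀ i, ContDiff ℝ ∞ fun y =>
      prodId h (D.φ 1) (f i y) - prodId h (D.φ 1) (stdLink m p n i y) := fun i =>
    (hP.comp (hf.smooth i)).sub (hP.comp (contDiff_stdLink m p n i))
  have hb0 : ∀ (i : Fin m) (y : E p), (¬ ∀ j, |y j| < 1) → fderiv ℝ (fun y =>
      prodId h (D.φ 1) (f i y) - prodId h (D.φ 1) (stdLink m p n i y)) y = 0 := fun i y hy =>
    fderiv_eq_zero_of_notMem_cube (hb i) (fun z hz => by rw [hf.std i z hz, sub_self]) hy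
  have hdiff : ∀ {g : E p → E n}, ContDiff ℝ ∞ g → DifferentiableAt ℝ g x := fun hg =>
    hg.differentiable (by simp) x
  have key : fderiv ℝ (joinSum D h f i) x =
      fderiv ℝ (stdLink m p n (Fin.castLE (Nat.sub_le m 1) i)) x := by
    have hA := (hdiff (contDiff_stdLink m p n (Fin.castLE (Nat.sub_le m 1) i))).hasFDerivAt.add
      (hdiff (hb (Fin.castLE (Nat.sub_le m 1) i))).hasFDerivAt
    rw [hb0 _ x h1, add_zero] at hA
    by_cases hi : (i : ℕ) + 1 = m - 1
    · have hBT := ((hb ⟨m - 1, by have := i.isLt; omega⟩).differentiable (by simp)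
        (shift D.k x)).hasFDerivAt.comp x (hT.differentiable (by simp) x).hasFDerivAt
      rw [hb0 _ _ fun hx => h2 ⟨hi, hx⟩, ContinuousLinearMap.zero_comp] at hBT
      have hAB := hA.add hBT
      rw [add_zero] at hAB
      refine HasFDerivAt.fderiv (hAB.congr_of_eventuallyEq (Filter.Eventually.of_forall ?_))
      intro y
      simp only [joinSum, hi, if_true]
      rfl
    · refine HasFDerivAt.fderiv (hA.congr_of_eventuallyEq (Filter.Eventually.of_forall ?_))
      intro y
      simp only [joinSum, hi, if_false, add_zero]
      rfl
  rw [key]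
  exact injective_fderiv_stdLink (by omega) _ x

/-! ### Injectivity of the join -/

theorem abs_stdLink_le {i : Fin m} {x : E p} (hx : ∀ j, |x j| ≤ 1) (j : Fin n) :
    |stdLink m p n i x j| ≤ 1 := by
  have := (abs_tstar_lt_one (m := m) (i := i + 1) (by omega) i.isLt).le
  simp only [stdLink]
  split_ifs
  · exact hx _
  · exact this
  · simp

theorem IsLongLink.abs_le {f : Fin m → E p → E n} (hf : IsLongLink m p n f) (i : Fin m) {x : E p}
    (hx : ∀ j, |x j| ≤ 1) (j : Fin n) : |f i x j| ≤ 1 := by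
  by_cases h : ∀ j, |x j| < 1
  · exact (hf.cube i x h j).le
  · rw [hf.std i x h]
    exact abs_stdLink_le hx j

/-- Images of the cube under the join meet a standard component only where expected. -/
theorem joinStep_disjoint_std (hn : n = c + p) (hp : 0 < p) (h : c + 1 ≤ n) (hc : 1 ≤ c)
    {y : E n} (hy : ∀ j, |y j| ≤ 1) {i : Fin m} (hi : (i : ℕ) + 1 ≤ m - 1) {x : E p}
    (hx : prodId h (D.φ 1) y = stdLink m p n i x) :
    (∀ j, |x j| ≤ 1) ∨ ((i : ℕ) + 1 = m - 1 ∧ ∀ j, |shift D.k x j| ≤ 1) := by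
  -- All coordinates of `x` but the first appear among those that `φ_1 × 1` leaves alone, so the
  -- bound on `y` passes to them. The first one is treated by projecting to `ℝ^{c+1}`.
  have hrest : ∀ j : Fin p, (j : ℕ) ≠ 0 → |x j| ≤ 1 := by
    intro j hj
    have hjn : c + j < n := by have := j.isLt; omega
    have h1 := hy ⟨c + j, hjn⟩
    rw [← prodId_apply_of_le h (D.φ 1) y (j := ⟨c + j, hjn⟩) (by simp; omega), hx,
      stdLink_apply_of_lt hn i x (j := ⟨c + j, hjn⟩) (by simp; omega)] at h1
    simpa using h1
  have h0 := congrArg (head h) hx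
  rw [head_prodId, head_stdLink hn hp] at h0
  rcases D.of_φ_one_eq_linePoint hc (fun j => hy _) (by omega) hi h0 with h1 | ⟨h1, h2⟩
  · left
    intro j
    by_cases hj : (j : ℕ) = 0
    · have : j = ⟨0, hp⟩ := Fin.ext hj
      rwa [this]
    · exact hrest j hj
  · refine Or.inr ⟨h1, fun j => ?_⟩
    by_cases hj : (j : ℕ) = 0
    · have : j = ⟨0, hp⟩ := Fin.ext hj
      rw [this]
      simpa [shift] using h2
    · simpa [shift, hj] using hrest j hj

/-- For two points in cubes, both `φ_1 × 1` and `f` are injective; for a cube and a standard part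
use `joinStep_disjoint_std`; two standard parts are told apart by `t_i` and their last `p`
coordinates. -/
theorem joinStep_injective (hn : n = c + p) (hp : 0 < p) (h : c + 1 ≤ n) (hc : 1 ≤ c)
    {f : Fin m → E p → E n} (hf : IsLongLink m p n f) :
    Function.Injective fun q : (_ : Fin (m - 1)) × E p => joinStep D h f q.1 q.2 := by
  have hfi : ∀ {i i' : Fin m} {x x' : E p}, prodId h (D.φ 1) (f i x) = prodId h (D.φ 1) (f i' x') →
      i = i' ∧ x = x' := by
    intro i i' x x' hx
    have := @hf.embedding.injective ⟨i, x⟩ ⟨i', x'⟩ (prodId_injective D h hx)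
    simpa using this
  have hcast : ∀ {i i' : Fin (m - 1)},
      Fin.castLE (Nat.sub_le m 1) i = Fin.castLE (Nat.sub_le m 1) i' → i = i' :=
    fun hi => Fin.castLE_injective _ hi
  have hdisj : ∀ {i : Fin m} {i' : Fin (m - 1)} {x x' : E p}, (∀ j, |x j| ≤ 1) →
      (¬ ∀ j, |x' j| ≤ 1) → ¬ ((i' : ℕ) + 1 = m - 1 ∧ ∀ j, |shift D.k x' j| ≤ 1) →
      prodId h (D.φ 1) (f i x) ≠ stdLink m p n (Fin.castLE (Nat.sub_le m 1) i') x' := by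
    intro i i' x x' hx h1 h2 he
    rcases joinStep_disjoint_std D hn hp h hc (hf.abs_le i hx)
      (by simp) he with h3 | h3
    · exact h1 h3
    · exact h2 (by simpa using h3)
  rintro ⟨i, x⟩ ⟨i', x'⟩ he
  have hi := i.isLt
  have hi' := i'.isLt
  simp only [joinStep] at he
  suffices i = i' ∧ x = x' by rw [this.1, this.2]
  split_ifs at he with h1 h2 h3 h4 h5 h6 h7 h8
  · exact ⟨hcast (hfi he).1, (hfi he).2⟩
  -- The unshifted cube carries a component of index below `m - 1`, the shifted one that of index `m
  -- - 1`.
  · have := congrArg Fin.val (hfi he).1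
    simp at this
    omega
  · exact absurd he (hdisj h1 h2 h3)
  · have := congrArg Fin.val (hfi he).1
    simp at this
    omega
  · exact ⟨Fin.ext (by omega), (shift_leftInverse _).injective (hfi he).2⟩
  · exact absurd he (hdisj h4.2 h5 h6)
  · exact absurd he.symm (hdisj h7 h1 h4)
  · exact absurd he.symm (hdisj h8.2 h1 h4)
  · have hz := congrArg (head h) he
    rw [head_stdLink hn hp, head_stdLink hn hp] at hz
    have h0 := congrArg (fun x : E (c + 1) => x 0) hz
    simp only [linePoint_zero hc] at h0
    have := tstar_injective m h0
    have hii : i = i' := Fin.ext (by simpa using this)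
    subst hii
    exact ⟨rfl, (tail_stdLink (by omega) _).injective he⟩

/-- The half-widths of the box that contains the first step of joining. -/
def halfWidth (c : ℕ) (k : ℝ) (j : ℕ) : ℝ := if j = 0 then 1 else if j < c + 1 then 2 * k else 1

theorem one_le_halfWidth (j : ℕ) : 1 ≤ halfWidth c D.k j := by
  have := D.two_lt_k
  unfold halfWidth
  split_ifs <;> linarith

theorem abs_stdLink_lt (hn : n = c + p) (i : Fin m) {x : E p}
    (hx : ∀ j : Fin p, |x j| < if (j : ℕ) = 0 then 2 * D.k else 1) (hc : 1 ≤ c) (j : Fin n) :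
    |stdLink m p n i x j| < halfWidth c D.k j := by
  have h1 := abs_tstar_lt_one (m := m) (i := i + 1) (by omega) i.isLt
  have hw := one_le_halfWidth D (j : ℕ)
  simp only [stdLink]
  split_ifs with h2 h3
  · refine (hx _).trans_le ?_
    simp only [halfWidth]
    split_ifs <;> first | rfl | omega
  · exact h1.trans_le hw
  · simp
    linarith

theorem IsLongLink.abs_lt {f : Fin m → E p → E n} (hf : IsLongLink m p n f)
    (hn : n = c + p) (i : Fin m) {x : E p}
    (hx : ∀ j : Fin p, |x j| < if (j : ℕ) = 0 then 2 * D.k else 1) (hc : 1 ≤ c) (j : Fin n) :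
    |f i x j| < halfWidth c D.k j := by
  by_cases h : ∀ j, |x j| < 1
  · exact (hf.cube i x h j).trans_le (one_le_halfWidth D _)
  · rw [hf.std i x h]
    exact abs_stdLink_lt D hn i hx hc j

theorem abs_prodId_lt (h : c + 1 ≤ n) {y : E n} (hy : ∀ j : Fin n, |y j| < halfWidth c D.k j)
    (j : Fin n) : |prodId h (D.φ 1) y j| < halfWidth c D.k j := by
  rcases lt_or_ge (j : ℕ) (c + 1) with hj | hj
  · rw [prodId_apply_of_lt h _ _ hj]
    have hz : ∀ l : Fin (c + 1), |head h y l| < if (l : ℕ) = 0 then 1 else 2 * D.k := by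
      intro l
      have := hy (Fin.castLE h l)
      simpa [halfWidth, head, l.isLt] using this
    have := D.φ_one_openBox hz ⟨j, hj⟩
    simpa [halfWidth, hj] using this
  · rw [prodId_apply_of_le h _ _ hj]
    exact hy j

/-- The first coordinate of `x` ranges up to `2k` because the final stretch multiplies it by `2k`;
the resulting box is the one that `shrink` takes into the open cube. -/
theorem abs_joinStep_lt (hn : n = c + p) (h : c + 1 ≤ n) (hc : 1 ≤ c)
    {f : Fin m → E p → E n} (hf : IsLongLink m p n f) (i : Fin (m - 1)) {x : E p}
    (hx : ∀ j : Fin p, |x j| < if (j : ℕ) = 0 then 2 * D.k else 1) (j : Fin n) :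
    |joinStep D h f i x j| < halfWidth c D.k j := by
  unfold joinStep
  split_ifs with h1 h2
  · exact abs_prodId_lt D h (hf.abs_lt D hn _ hx hc) j
  · refine abs_prodId_lt D h (hf.abs_lt D hn _ (fun l => ?_) hc) j
    by_cases hl : (l : ℕ) = 0
    · rw [if_pos hl]
      have := h2.2 l
      linarith [D.two_lt_k]
    · have := hx l
      simpa [shift, hl] using this
  · exact abs_stdLink_lt D hn _ hx hc j

/-- The stretched first coordinate of `x` sits in coordinate `c`, where `shrink` divides by the same
factor, and `S` takes each `t_i` for `m` to that for `m - 1`. -/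
theorem shrink_stdLink_stretch (hn : n = c + p) (hc : 1 ≤ c)
    (i : Fin (m - 1)) (x : E p) :
    shrink c D.S (2 * D.k)
      (stdLink m p n (Fin.castLE (Nat.sub_le m 1) i) (stretch (2 * D.k) x)) =
      stdLink (m - 1) p n i x := by
  have hk := D.two_lt_k
  have hi := i.isLt
  subst hn
  ext j
  by_cases h0 : (j : ℕ) = 0
  · have h2 : ¬ c = 0 := by omega
    simp [shrink, stdLink, h0, h2, D.S_std (i + 1) (by omega) (by omega)]
  · rcases lt_trichotomy (j : ℕ) c with hj | hj | hj
    · simp [shrink, stdLink, h0, show ¬ c ≤ (j : ℕ) by omega]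
    · have : D.k ≠ 0 := by linarith
      simp [shrink, stdLink, hj, stretch, show ¬ c = 0 by omega]
      field_simp
    · simp [shrink, stdLink, h0, stretch, hj.le, show ¬ (j : ℕ) ≤ c by omega]
      omega

theorem joinSum_eq_std (h : c + 1 ≤ n) {f : Fin m → E p → E n}
    {i : Fin (m - 1)} {x : E p}
    (hx : f (Fin.castLE (Nat.sub_le m 1) i) x = stdLink m p n (Fin.castLE (Nat.sub_le m 1) i) x)
    (hx' : f ⟨m - 1, by have := i.isLt; omega⟩ (shift D.k x) =
      stdLink m p n ⟨m - 1, by have := i.isLt; omega⟩ (shift D.k x)) :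
    joinSum D h f i x = stdLink m p n (Fin.castLE (Nat.sub_le m 1) i) x := by
  simp [joinSum, hx, hx']

theorem joinFun_std (hn : n = c + p) (hp : 0 < p) (h : c + 1 ≤ n) (hc : 1 ≤ c)
    {f : Fin m → E p → E n}
    (hf : ∀ i x, ¬ (∀ j, |x j| < 1) → f i x = stdLink m p n i x) (i : Fin (m - 1)) {x : E p}
    (hx : ¬ ∀ j, |x j| < 1) : joinFun D h f i x = stdLink (m - 1) p n i x := by
  have hk := D.two_lt_k
  rw [joinFun_eq D hn hp h hc hf, joinSum_eq_std, shrink_stdLink_stretch D hn hc]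
  -- Both `|2k x₁| < 1` and `|2k x₁ - k| < 1` force `|x₁| < 1`, since `k + 1 < 2k`; so outside the
  -- cube neither difference contributes.
  all_goals
    refine hf _ _ fun hx' => hx fun j => ?_
    have hj := hx' j
    by_cases h0 : (j : ℕ) = 0
    · simp only [shift, stretch, h0, if_true] at hj
      rw [_root_.abs_lt] at hj ⊢
      constructor <;> nlinarith
    · simpa [shift, stretch, h0] using hj

/-- The join of a long link is a long link. -/
theorem isLongLink_joinFun (hn : n = c + p) (hp : 0 < p) (h : c + 1 ≤ n) (hc : 1 ≤ c)
    {f : Fin m → E p → E n} (hf : IsLongLink m p n f) :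
    IsLongLink (m - 1) p n (joinFun D h f) := by
  have hk := D.two_lt_k
  have hk0 : 2 * D.k ≠ 0 := by linarith
  have heq : ∀ i, joinFun D h f i =
      fun x => shrink c D.S (2 * D.k) (joinSum D h f i (stretch (2 * D.k) x)) := fun i =>
    funext (joinFun_eq D hn hp h hc hf.std i)
  have hR := contDiff_shrink (n := n) c D.S_smooth (2 * D.k)
  have hsum := contDiff_joinSum D h hf.smooth
  have hSt := contDiff_stretch (p := p) (2 * D.k)
  have hsmooth : ∀ i, ContDiff ℝ ∞ (joinFun D h f i) := fun i => by
    rw [heq]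
    exact hR.comp ((hsum i).comp hSt)
  have hstd : ∀ i x, ¬ (∀ j, |x j| < 1) → joinFun D h f i x = stdLink (m - 1) p n i x :=
    fun i x hx => joinFun_std D hn hp h hc hf.std i hx
  refine ⟨hsmooth, fun i x => ?_, ?_, fun i x hx j => ?_, hstd⟩
  · rw [heq]
    exact injective_fderiv_comp hR ((hsum i).comp hSt) x
      (injective_fderiv_shrink D.S_smooth D.S_deriv hk0 _)
      (injective_fderiv_comp (hsum i) hSt x (injective_fderiv_joinSum D hn hp h hc hf i _)
        (injective_fderiv_of_leftInverse (contDiff_stretch _) hSt (stretch_leftInverse hk0) x))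
  · refine isEmbedding_of_std (by omega) (fun i => (hsmooth i).continuous) hstd ?_
    rintro ⟨i, x⟩ ⟨i', x'⟩ he
    have h1 := shrink_injective D.S_injective hk0 he
    have h2 := @joinStep_injective _ _ _ _ D hn hp h hc _ hf ⟨i, _⟩ ⟨i', _⟩ h1
    simp only [Sigma.mk.injEq, heq_eq_eq] at h2 ⊢
    exact ⟨h2.1, (stretch_leftInverse hk0).injective h2.2⟩
  · have hx' : ∀ j : Fin p,
        |stretch (2 * D.k) x j| < if (j : ℕ) = 0 then 2 * D.k else 1 := by
      intro j
      have := hx j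
      simp only [stretch]
      split_ifs
      · rw [abs_mul, abs_of_pos (by linarith)]
        nlinarith
      · exact this
    have hj := abs_joinStep_lt D hn h hc hf i hx' j
    simp only [joinFun, shrink]
    unfold halfWidth at hj
    split_ifs at hj ⊢
    · exact _root_.abs_lt.2 (D.S_maps (_root_.abs_lt.1 hj))
    · rw [abs_div, abs_of_pos (by linarith : 0 < 2 * D.k), div_lt_one (by linarith)]
      exact hj
    · exact hj

end Join

/-! ### Graphing -/

/-- The first `p` coordinates of a point of `ℝ^{p+1}`. -/
def init {p : ℕ} (x : E (p + 1)) : E p := WithLp.toLp 2 fun a : Fin p => x a.castSucc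

theorem contDiff_init (p : ℕ) : ContDiff ℝ ∞ (init : E (p + 1) → E p) :=
  contDiff_toLp fun _ => contDiff_coord _

/-- The point `(y, t)` of `ℝ^{n+1}`. -/
def snoc {n : ℕ} (y : E n) (t : ℝ) : E (n + 1) :=
  WithLp.toLp 2 (Fin.snoc (α := fun _ => ℝ) (fun j : Fin n => y j) t)

@[simp] theorem snoc_last {n : ℕ} (y : E n) (t : ℝ) : snoc y t (Fin.last n) = t := by
  simp [snoc]

@[simp] theorem snoc_castSucc {n : ℕ} (y : E n) (t : ℝ) (j : Fin n) :
    snoc y t j.castSucc = y j := by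
  simp [snoc]

theorem ext_castSucc_last {n : ℕ} {y z : E (n + 1)} (h : ∀ j : Fin n, y j.castSucc = z j.castSucc)
    (hl : y (Fin.last n) = z (Fin.last n)) : y = z := by
  ext j
  induction j using Fin.lastCases with
  | last => exact hl
  | cast j => exact h j

theorem snoc_inj {n : ℕ} {y z : E n} {s t : ℝ} : snoc y s = snoc z t ↔ y = z ∧ s = t := by
  constructor
  · intro h
    constructor
    · ext j
      rw [← snoc_castSucc y s, h, snoc_castSucc]
    · rw [← snoc_last y s, h, snoc_last]
  · rintro ⟨rfl, rfl⟩
    rfl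

theorem contDiff_snoc {V : Type*} [NormedAddCommGroup V] [NormedSpace ℝ V] {n : ℕ} {y : V → E n}
    {t : V → ℝ} (hy : ContDiff ℝ ∞ y) (ht : ContDiff ℝ ∞ t) :
    ContDiff ℝ ∞ fun v => snoc (y v) (t v) := by
  refine contDiff_euclidean.2 fun j => ?_
  induction j using Fin.lastCases with
  | last => simpa using ht
  | cast j =>
    simp only [snoc_castSucc]
    exact (contDiff_coord j).comp hy

theorem stdLink_succ (m p n : ℕ) (i : Fin m) (x : E (p + 1)) :
    stdLink m (p + 1) (n + 1) i x = snoc (stdLink m p n i (init x)) (x (Fin.last p)) := by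
  refine ext_castSucc_last (fun j => ?_) ?_
  · rw [snoc_castSucc]
    have h : n + 1 ≤ (j : ℕ) + (p + 1) ↔ n ≤ (j : ℕ) + p := by omega
    by_cases hj : n ≤ (j : ℕ) + p
    · have hj' : n + 1 ≤ (j : ℕ) + (p + 1) := h.2 hj
      simp only [stdLink, Fin.val_castSucc, hj, hj', dif_pos, init]
      exact congrArg x.ofLp (Fin.ext (by simp only [Fin.val_castSucc]; omega))
    · have hj' : ¬ n + 1 ≤ (j : ℕ) + (p + 1) := fun hj' => hj (h.1 hj')
      simp only [stdLink, Fin.val_castSucc, hj, hj', dif_neg, not_false_eq_true]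
  · rw [snoc_last]
    have h : n + 1 ≤ n + (p + 1) := by omega
    simp only [stdLink, Fin.val_last, h, dif_pos]
    exact congrArg x.ofLp (Fin.ext (by simp only [Fin.val_last]; omega))

variable {m p n : ℕ}

theorem graphFun_eq_snoc (l : LoopLink m p n) (i : Fin m) (x : E (p + 1)) :
    graphFun l i x = snoc ((l.link (x (Fin.last p))).toFun i (init x)) (x (Fin.last p)) :=
  rfl

/-- By continuity, a loop is at the base point also at the times `-1` and `1`. -/
theorem LoopLink.link_eq_std (l : LoopLink m p n) {t : ℝ} (ht : 1 ≤ |t|) (i : Fin m) (x : E p) :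
    (l.link t).toFun i x = stdLink m p n i x := by
  have hc : Continuous fun t => (l.link t).toFun i x :=
    (l.smooth i).continuous.comp (Continuous.prodMk_left x)
  have hcl : IsClosed {t | (l.link t).toFun i x = stdLink m p n i x} :=
    isClosed_eq hc continuous_const
  have hsub : (Icc (-1 : ℝ) 1)ᶜ ⊆ {t | (l.link t).toFun i x = stdLink m p n i x} :=
    fun t ht => congrFun (congrFun (l.based t ht) i) x
  refine closure_minimal hsub hcl (mem_closure_of_forall_one_lt_smul fun r hr hmem => ?_)
  have := abs_le.2 hmem
  rw [smul_eq_mul, abs_mul, abs_of_pos (by linarith)] at this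
  nlinarith

theorem fderiv_snoc {V : Type*} [NormedAddCommGroup V] [NormedSpace ℝ V] {y : V → E n}
    {t : V → ℝ} (hy : ContDiff ℝ ∞ y) (ht : ContDiff ℝ ∞ t) (x v : V) :
    fderiv ℝ (fun v => snoc (y v) (t v)) x v = snoc (fderiv ℝ y x v) (fderiv ℝ t x v) := by
  refine ext_castSucc_last (fun j => ?_) ?_
  · rw [fderiv_apply_coord (contDiff_snoc hy ht), snoc_castSucc, fderiv_apply_coord hy]
    simp only [snoc_castSucc]
  · rw [fderiv_apply_coord (contDiff_snoc hy ht), snoc_last]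
    simp only [snoc_last]

/-- The graph of a loop of long links is a long link. -/
theorem isLongLink_graphFun (hpn : p ≤ n) (l : LoopLink m p n) :
    IsLongLink m (p + 1) (n + 1) (graphFun l) := by
  have hlast := contDiff_coord (Fin.last p)
  have hpair : ContDiff ℝ ∞ fun x : E (p + 1) => (x (Fin.last p), init x) :=
    hlast.prodMk (contDiff_init p)
  have hfirst : ∀ i, ContDiff ℝ ∞ fun x : E (p + 1) =>
      (l.link (x (Fin.last p))).toFun i (init x) := fun i => (l.smooth i).comp hpair
  have hsmooth : ∀ i, ContDiff ℝ ∞ (graphFun l i) := fun i => contDiff_snoc (hfirst i) hlast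
  have hstd : ∀ i x, ¬ (∀ j, |x j| < 1) → graphFun l i x = stdLink m (p + 1) (n + 1) i x := by
    intro i x hx
    rw [graphFun_eq_snoc, stdLink_succ]
    congr 1
    -- Outside the cube, either the time is in `(-1,1)` and the link at that time is evaluated
    -- outside its cube, or the loop is at the base point.
    by_cases ht : |x (Fin.last p)| < 1
    · refine (l.link _).isLongLink.std i _ fun h => hx fun j => ?_
      induction j using Fin.lastCases with
      | last => exact ht
      | cast j => exact h j
    · exact l.link_eq_std (not_lt.1 ht) i _
  refine ⟨hsmooth, fun i x => ?_, ?_, fun i x hx j => ?_, hstd⟩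
  -- For a kernel vector, the last coordinate of the derivative shows that its time component is
  -- zero. What remains is the derivative of the link at a fixed time, which is injective.
  · rw [injective_iff_map_eq_zero]
    intro v hv
    have hv' : snoc (fderiv ℝ (fun x : E (p + 1) =>
        (l.link (x (Fin.last p))).toFun i (init x)) x v)
        (fderiv ℝ (fun x : E (p + 1) => x (Fin.last p)) x v) = snoc 0 0 := by
      rw [← fderiv_snoc (hfirst i) hlast]
      refine Eq.trans hv ?_
      refine ext_castSucc_last (fun j => ?_) ?_ <;> simp
    obtain ⟨h1, h2⟩ := snoc_inj.1 hv'
    have hpr : HasFDerivAt (fun x : E (p + 1) => x (Fin.last p))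
        (EuclideanSpace.proj (Fin.last p) : E (p + 1) →L[ℝ] ℝ) x :=
      (EuclideanSpace.proj (Fin.last p) : E (p + 1) →L[ℝ] ℝ).hasFDerivAt
    have hvl : v (Fin.last p) = 0 := by
      rw [hpr.fderiv] at h2
      exact h2
    set F := fun q : ℝ × E p => (l.link q.1).toFun i q.2 with hF
    have hFd : ∀ q, HasFDerivAt F (fderiv ℝ F q) q := fun q =>
      ((l.smooth i).differentiable (by simp) q).hasFDerivAt
    have hin := ((contDiff_init p).differentiable (by simp) x).hasFDerivAt
    have hcomp := (hFd (x (Fin.last p), init x)).comp x (hpr.prodMk hin)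
    have h3 : fderiv ℝ F (x (Fin.last p), init x)
        ((0 : ℝ), fderiv ℝ (init : E (p + 1) → E p) x v) = 0 := by
      have := DFunLike.congr_fun hcomp.fderiv v
      rw [← hvl]
      exact this.symm.trans h1
    have hslice := (hFd (x (Fin.last p), init x)).comp (init x)
      (hasFDerivAt_prodMk_right (𝕜 := ℝ) (x (Fin.last p)) (init x))
    have h4 : fderiv ℝ ((l.link (x (Fin.last p))).toFun i) (init x)
        (fderiv ℝ (init : E (p + 1) → E p) x v) = 0 :=
      (DFunLike.congr_fun hslice.fderiv _).trans h3
    have h5 := (injective_iff_map_eq_zero _).1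
      ((l.link (x (Fin.last p))).isLongLink.immersion i (init x)) _ h4
    refine ext_castSucc_last (fun j => ?_) hvl
    have h6 : fderiv ℝ (init : E (p + 1) → E p) x v j = 0 := by rw [h5]; rfl
    rw [fderiv_apply_coord (contDiff_init p)] at h6
    have hprj : HasFDerivAt (fun x : E (p + 1) => init x j)
        (EuclideanSpace.proj j.castSucc : E (p + 1) →L[ℝ] ℝ) x :=
      (EuclideanSpace.proj j.castSucc : E (p + 1) →L[ℝ] ℝ).hasFDerivAt
    rw [hprj.fderiv] at h6
    exact h6
  · refine isEmbedding_of_std (by omega) (fun i => (hsmooth i).continuous) hstd ?_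
    rintro ⟨i, x⟩ ⟨i', x'⟩ he
    simp only [graphFun_eq_snoc] at he
    obtain ⟨h1, h2⟩ := snoc_inj.1 he
    -- Equal last coordinates mean equal times, so injectivity of a single link suffices.
    rw [h2] at h1
    have h3 := @(l.link (x' (Fin.last p))).isLongLink.embedding.injective ⟨i, _⟩ ⟨i', _⟩ h1
    simp only [Sigma.mk.injEq, heq_eq_eq] at h3 ⊢
    refine ⟨h3.1, ext_castSucc_last (fun j => ?_) h2⟩
    exact congrArg (fun y : E p => y j) h3.2
  · rw [graphFun_eq_snoc]
    induction j using Fin.lastCases with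
    | last => simpa using hx (Fin.last p)
    | cast j =>
      rw [snoc_castSucc]
      exact (l.link _).isLongLink.cube i _ (fun a => hx a.castSucc) j

/-- The graphing map. -/
def graph (hpn : p ≤ n) (l : LoopLink m p n) : LongLink m (p + 1) (n + 1) :=
  ⟨graphFun l, isLongLink_graphFun hpn l⟩

/-- Each component of the graph is an affine expression in the corresponding component of the loop,
precomposed with a fixed map. -/
theorem continuous_graph (hpn : p ≤ n) :
    Continuous (graph hpn : LoopLink m p n → LongLink m (p + 1) (n + 1)) := by
  refine LongLink.continuous_of_component fun i => ?_
  have hlast := contDiff_coord (Fin.last p)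
  let X : SmoothMap (E (p + 1)) (ℝ × E p) :=
    ⟨fun x => (x (Fin.last p), init x), hlast.prodMk (contDiff_init p)⟩
  let L : SmoothMap (E n) (E (n + 1)) :=
    ⟨fun y => snoc y 0, contDiff_snoc contDiff_id contDiff_const⟩
  let t : SmoothMap (E (p + 1)) (E (n + 1)) :=
    ⟨fun x => snoc 0 (x (Fin.last p)), contDiff_snoc contDiff_const hlast⟩
  have key : ∀ l : LoopLink m p n, LongLink.component i (graph hpn l) =
      (L.comp ((LoopLink.component i l).comp X)).add t := fun l => SmoothMap.ext fun x =>
    ext_castSucc_last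
      (fun j => by
        simp [LongLink.component, graph, graphFun_eq_snoc, SmoothMap.comp, SmoothMap.add, L, t, X,
          LoopLink.component])
      (by simp [LongLink.component, graph, graphFun_eq_snoc, SmoothMap.comp, SmoothMap.add, L, t])
  simp only [key]
  exact SmoothMap.continuous_add (SmoothMap.continuous_comp continuous_const
    (SmoothMap.continuous_comp (LoopLink.continuous_component i) continuous_const))
    continuous_const

/-! ### Joining long links and loops of long links -/

section Join

variable {c : ℕ} (D : JoiningData m c)

/-- The joining map. -/
def join (hn : n = c + p) (hp : 0 < p) (h : c + 1 ≤ n) (hc : 1 ≤ c) (f : LongLink m p n) :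
    LongLink (m - 1) p n :=
  ⟨joinFun D h f.toFun, isLongLink_joinFun D hn hp h hc f.isLongLink⟩

theorem continuous_join (hn : n = c + p) (hp : 0 < p) (h : c + 1 ≤ n) (hc : 1 ≤ c) :
    Continuous (join D hn hp h hc) := by
  refine LongLink.continuous_of_component fun i => ?_
  let X : SmoothMap (E p) (E p) := ⟨stretch (2 * D.k), contDiff_stretch _⟩
  let T : SmoothMap (E p) (E p) := ⟨shift D.k, contDiff_shift _⟩
  have hlt : m - 1 < m := by have := i.isLt; omega
  have key : ∀ f : LongLink m p n, LongLink.component i (join D hn hp h hc f) =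
      joinMap D h i X ((LongLink.component (Fin.castLE (Nat.sub_le m 1) i) f).comp X)
        ((LongLink.component ⟨m - 1, hlt⟩ f).comp (T.comp X)) := fun f =>
    SmoothMap.ext fun x => (joinFun_eq D hn hp h hc f.isLongLink.std i x).trans
      (joinMap_apply D h i X _ _ x (F := f.toFun) rfl rfl).symm
  simp only [key]
  exact continuous_joinMap D h i X
    (SmoothMap.continuous_comp (LongLink.continuous_component _) continuous_const)
    (SmoothMap.continuous_comp (LongLink.continuous_component _) continuous_const)

/-- The components of the join of a loop, as smooth maps on `ℝ × ℝ^p`. -/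
def loopJoinMap (h : c + 1 ≤ n) (i : Fin (m - 1)) (l : LoopLink m p n) :
    SmoothMap (ℝ × E p) (E n) :=
  joinMap D h i
    ⟨fun q => stretch (2 * D.k) q.2, (contDiff_stretch _).comp contDiff_snd⟩
    ((LoopLink.component (Fin.castLE (Nat.sub_le m 1) i) l).comp
      ⟨fun q => (q.1, stretch (2 * D.k) q.2),
        contDiff_fst.prodMk ((contDiff_stretch _).comp contDiff_snd)⟩)
    ((LoopLink.component ⟨m - 1, by have := i.isLt; omega⟩ l).comp
      ⟨fun q => (q.1, shift D.k (stretch (2 * D.k) q.2)),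
        contDiff_fst.prodMk
          ((contDiff_shift _).comp ((contDiff_stretch _).comp contDiff_snd))⟩)

theorem continuous_loopJoinMap (h : c + 1 ≤ n) (i : Fin (m - 1)) :
    Continuous (loopJoinMap D h i : LoopLink m p n → _) :=
  continuous_joinMap D h i _
    (SmoothMap.continuous_comp (LoopLink.continuous_component _) continuous_const)
    (SmoothMap.continuous_comp (LoopLink.continuous_component _) continuous_const)

theorem loopJoinMap_apply (hn : n = c + p) (hp : 0 < p) (h : c + 1 ≤ n) (hc : 1 ≤ c)
    (i : Fin (m - 1)) (l : LoopLink m p n) (q : ℝ × E p) :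
    (loopJoinMap D h i l).toFun q = (join D hn hp h hc (l.link q.1)).toFun i q.2 :=
  (joinMap_apply D h i _ _ _ q (F := (l.link q.1).toFun) rfl rfl).trans
    (joinFun_eq D hn hp h hc (l.link q.1).isLongLink.std i q.2).symm

/-- Joining applied to a loop. -/
def loopJoin (hn : n = c + p) (hp : 0 < p) (h : c + 1 ≤ n) (hc : 1 ≤ c) (l : LoopLink m p n) :
    LoopLink (m - 1) p n where
  link t := join D hn hp h hc (l.link t)
  smooth i := by
    simpa only [← loopJoinMap_apply D hn hp h hc i l] using (loopJoinMap D h i l).smooth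
  based t ht := by
    have hl := l.based t ht
    funext i x
    refine (joinFun_eq D hn hp h hc (l.link t).isLongLink.std i x).trans ?_
    -- At the base point both differences in the sum vanish.
    rw [joinSum_eq_std D h (by rw [hl]) (by rw [hl]), shrink_stdLink_stretch D hn hc]

theorem continuous_loopJoin (hn : n = c + p) (hp : 0 < p) (h : c + 1 ≤ n) (hc : 1 ≤ c) :
    Continuous (loopJoin D hn hp h hc) := by
  refine LoopLink.continuous_of_component fun i => ?_
  have key : ∀ l : LoopLink m p n, LoopLink.component i (loopJoin D hn hp h hc l) =
      loopJoinMap D h i l := fun l => SmoothMap.ext fun q =>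
    (loopJoinMap_apply D hn hp h hc i l q).symm
  simp only [key]
  exact continuous_loopJoinMap D h i

/-! ### Joining commutes with graphing -/

/-- The appended coordinate has index `n ≥ c + 1`, beyond those on which `φ` acts. -/
theorem prodId_snoc (h : c + 1 ≤ n) (h' : c + 1 ≤ n + 1) (φ : E (c + 1) → E (c + 1)) (y : E n)
    (t : ℝ) : prodId h' φ (snoc y t) = snoc (prodId h φ y) t := by
  have hh : head h' (snoc y t) = head h y := by
    ext l
    exact snoc_castSucc y t (Fin.castLE h l)
  refine ext_castSucc_last (fun j => ?_) ?_
  · rw [snoc_castSucc]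
    rcases lt_or_ge (j : ℕ) (c + 1) with hj | hj
    · rw [prodId_apply_of_lt h _ _ hj, prodId_apply_of_lt h' _ _ (j := j.castSucc) hj, hh]
      rfl
    · rw [prodId_apply_of_le h _ _ hj, prodId_apply_of_le h' _ _ (j := j.castSucc) hj,
        snoc_castSucc]
  · rw [prodId_apply_of_le h' _ _ (by simpa using h), snoc_last, snoc_last]

theorem shrink_snoc (h : c + 1 ≤ n) (S : ℝ → ℝ) (r : ℝ) (y : E n) (t : ℝ) :
    shrink c S r (snoc y t) = snoc (shrink c S r y) t := by
  refine ext_castSucc_last (fun j => ?_) ?_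
  · rw [snoc_castSucc]
    simp only [shrink, Fin.val_castSucc, snoc_castSucc]
  · rw [snoc_last]
    have h1 : n ≠ 0 := by omega
    have h2 : ¬ n < c + 1 := by omega
    simp only [shrink, Fin.val_last, h1, h2, if_false, snoc_last]

theorem init_shift (k : ℝ) (x : E (p + 1)) : init (shift k x) = shift k (init x) := by
  ext j
  simp only [init, shift, Fin.val_castSucc]

/-- This is where `p ≥ 1` enters: the time coordinate of `ℝ^{p+1}` is not the first one. -/
theorem shift_last (hp : 0 < p) (k : ℝ) (x : E (p + 1)) :
    shift k x (Fin.last p) = x (Fin.last p) := by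
  simp [shift, hp.ne']

theorem init_stretch (r : ℝ) (x : E (p + 1)) : init (stretch r x) = stretch r (init x) := by
  ext j
  simp only [init, stretch, Fin.val_castSucc]

theorem stretch_last (hp : 0 < p) (r : ℝ) (x : E (p + 1)) :
    stretch r x (Fin.last p) = x (Fin.last p) := by
  simp [stretch, hp.ne']

theorem snoc_add (y z : E n) (s t : ℝ) : snoc y s + snoc z t = snoc (y + z) (s + t) :=
  ext_castSucc_last (fun j => by simp) (by simp)

theorem snoc_sub (y z : E n) (s t : ℝ) : snoc y s - snoc z t = snoc (y - z) (s - t) :=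
  ext_castSucc_last (fun j => by simp) (by simp)

/-- All terms are taken at the same time `t`, since the shift preserves it; in the last coordinate
they contribute `t` and differences `t - t`. -/
theorem joinSum_graphFun (hp : 0 < p) (h : c + 1 ≤ n) (h' : c + 1 ≤ n + 1)
    (l : LoopLink m p n) (i : Fin (m - 1)) (x : E (p + 1)) :
    joinSum D h' (graphFun l) i x =
      snoc (joinSum D h (l.link (x (Fin.last p))).toFun i (init x)) (x (Fin.last p)) := by
  unfold joinSum
  split_ifs
  · simp only [graphFun_eq_snoc, stdLink_succ, shift_last hp, init_shift, prodId_snoc h h',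
      snoc_sub, snoc_add, sub_self, add_zero]
  · simp only [graphFun_eq_snoc, stdLink_succ, prodId_snoc h h',
      snoc_sub, snoc_add, sub_self, add_zero]

theorem joinFun_graphFun (hn : n = c + p) (hp : 0 < p) (h : c + 1 ≤ n) (h' : c + 1 ≤ n + 1)
    (hc : 1 ≤ c) (l : LoopLink m p n) :
    joinFun D h' (graphFun l) = graphFun (loopJoin D hn hp h hc l) := by
  funext i x
  rw [joinFun_eq D (by omega) (by omega) h' hc (isLongLink_graphFun (by omega) l).std,
    joinSum_graphFun D hp h, shrink_snoc h, init_stretch, stretch_last hp, graphFun_eq_snoc]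
  congr 1
  exact (joinFun_eq D hn hp h hc (l.link _).isLongLink.std i _).symm

end Join

theorem LongLink.ext {f g : LongLink m p n} (h : f.toFun = g.toFun) : f = g := by
  cases f
  cases g
  congr

end LongLinks

end

/-! ### The main theorem -/

open LongLinks in
theorem propositionP (m p n : ℕ) (hm : 2 ≤ m) (hp : 1 ≤ p) (hpn : p + 2 ≤ n)
    (D : JoiningData m (n - p)) :
    ∃ (J : C(LongLink m p n, LongLink (m - 1) p n))
      (J' : C(LongLink m (p + 1) (n + 1), LongLink (m - 1) (p + 1) (n + 1)))
      (ΩJ : C(LoopLink m p n, LoopLink (m - 1) p n))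
      (G : C(LoopLink m p n, LongLink m (p + 1) (n + 1)))
      (G' : C(LoopLink (m - 1) p n, LongLink (m - 1) (p + 1) (n + 1))),
      (∀ f, (J f).toFun = joinFun D (by omega) f.toFun) ∧
      (∀ f, (J' f).toFun = joinFun D (by omega) f.toFun) ∧
      (∀ l t, (ΩJ l).link t = J (l.link t)) ∧
      (∀ l, (G l).toFun = graphFun l) ∧
      (∀ l, (G' l).toFun = graphFun l) ∧
      J'.comp G = G'.comp ΩJ ∧
      ContinuousMap.Homotopic (J'.comp G) (G'.comp ΩJ) := by
  have hn : n = (n - p) + p := by omega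
  -- The codimension is the same in both dimensions, so the same joining data serve twice.
  have hn' : n + 1 = (n - p) + (p + 1) := by omega
  have h : n - p + 1 ≤ n := by omega
  have h' : n - p + 1 ≤ n + 1 := by omega
  have hc : 1 ≤ n - p := by omega
  let J : C(LongLink m p n, LongLink (m - 1) p n) := ⟨_, continuous_join D hn hp h hc⟩
  let J' : C(LongLink m (p + 1) (n + 1), LongLink (m - 1) (p + 1) (n + 1)) :=
    ⟨_, continuous_join D hn' p.succ_pos h' hc⟩
  let ΩJ : C(LoopLink m p n, LoopLink (m - 1) p n) := ⟨_, continuous_loopJoin D hn hp h hc⟩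
  let G : C(LoopLink m p n, LongLink m (p + 1) (n + 1)) :=
    ⟨_, continuous_graph (by omega)⟩
  let G' : C(LoopLink (m - 1) p n, LongLink (m - 1) (p + 1) (n + 1)) :=
    ⟨_, continuous_graph (by omega)⟩
  have hcomm : J'.comp G = G'.comp ΩJ := by
    ext l
    exact LongLink.ext (joinFun_graphFun D hn hp h h' hc l)
  refine ⟨J, J', ΩJ, G, G', fun _ => rfl, fun _ => rfl, fun _ _ => rfl, fun _ => rfl,
    fun _ => rfl, hcomm, ?_⟩
  -- The two maps now coincide, and `rw` closes the goal by reflexivity of homotopy.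
  rw [hcomm]
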